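/- A *Halin graph* is a graph obtained from a plane embedding of a finite tree with at least three leaves by adding a cycle that passes through all the leaves (and only the leaves) with no crossing edges; here the tree may have vertices of degree two. A graph is *subcubic* if all its vertices have degree at most $3$. An *adjacent-vertex-distinguishing* (AVD) coloring of a graph $G$ is a proper edge-coloring $\varphi$ such that $\varphi[u]\neq\varphi[v]$ for any two adjacent vertices $u,v$, where $\varphi[x]$ denotes the set of colors on the edges incident with $x$; $\chi'_{avd}(G)$ is the smallest number of colors in an AVD coloring of $G$. Let $K_4$ be the complete graph on four vertices. For $n\in\{4,5\}$, let $H_n$ be the cubic Halin graph on $2n+2$ vertices whose tree consists of a path $s_0s_1\cdots s_{n-1}$ together with $n+2$ leaves $p_0,\dots,p_{n+1}$, where $p_0$ and $p_1$ are attached to $s_0$, $p_{i+1}$ is attached to $s_i$ for $1\le i\le n-2$, and $p_n$ and $p_{n+1}$ are attached to $s_{n-1}$, and whose outer cycle is $p_0p_1\cdots p_{n+1}p_0$. Let $H_8$ be the cubic Halin graph on $18$ vertices whose tree has the inner vertices $s_0,\dots,s_7$ with edges $s_1s_0,\ s_1s_2,\ s_2s_3,\ s_3s_4,\ s_1s_5,\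 s_5s_6,\ s_6s_7$ and the leaves $p_0,\dots,p_9$, where $p_0,p_1$ are attached to $s_0$, $p_2$ to $s_2$, $p_3$ to $s_3$, $p_4,p_5$ to $s_4$, $p_6,p_7$ to $s_7$, $p_8$ to $s_6$, $p_9$ to $s_5$, and whose outer cycle is $p_0p_1\cdots p_9p_0$. **Theorem.** Let $H$ be a subcubic Halin graph that is not isomorphic to $K_4$, $H_4$, $H_5$ or $H_8$. Then $$\chi'_{avd}(H)=4.$$ -/

import Mathlib

/-- A plane tree, as a combinatorial embedding: a tree together with a rotation system, i.e. for
every vertex `v` the cyclic order (say, counterclockwise) in which the neighbours of `v` appear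
around `v`. (For a tree, every rotation system is that of an embedding in the plane.) -/
structure PlaneTree (V : Type*) where
  /-- The underlying tree. -/
  graph : SimpleGraph V
  isTree : graph.IsTree
  /-- The successor of each neighbour of `v` in the cyclic order around `v`. -/
  rot : ∀ v : V, Equiv.Perm (graph.neighborSet v)
  /-- The rotation at `v` is one single cycle through all the neighbours of `v`. -/
  rot_isCycleOn : ∀ v : V, (rot v).IsCycleOn Set.univ

namespace PlaneTree

variable {V : Type*} (P : PlaneTree V)

/-- One step of the walk along the boundary of the unique face of a plane tree: having traversed
the directed edge `u → v`, leave `v` by the edge that follows `v u` in the rotation at `v`. -/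
def faceStep (d : P.graph.Dart) : P.graph.Dart :=
  ⟨(d.snd, (P.rot d.snd ⟨d.fst, d.adj.symm⟩ : V)),
    (P.rot d.snd ⟨d.fst, d.adj.symm⟩).property⟩

/-- A leaf is a vertex with exactly one neighbour. -/
def IsLeaf (v : V) : Prop := ∃! w, P.graph.Adj v w

/-- `P.NextLeaf u v`: the face-boundary walk that starts at the leaf `u` meets the leaf `v` as
its first leaf after `u`. -/
def NextLeaf (u v : V) : Prop :=
  P.IsLeaf u ∧ P.IsLeaf v ∧ ∃ (d : P.graph.Dart) (n : ℕ),
    d.fst = u ∧ (P.faceStep^[n] d).snd = v ∧ ∀ k < n, ¬ P.IsLeaf (P.faceStep^[k] d).snd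

end PlaneTree

/-- A graph is Halin if it is obtained from a plane tree with at least three leaves by adding a
cycle passing through all the leaves with no crossing edges, that is, the cycle joining the
leaves in the order in which they occur along the boundary of the face of the plane tree.
Vertices of degree two are allowed in the tree. -/
def IsHalin {V : Type*} (G : SimpleGraph V) : Prop :=
  ∃ P : PlaneTree V, 3 ≤ {v | P.IsLeaf v}.encard ∧
    ∀ u v, G.Adj u v ↔ P.graph.Adj u v ∨ P.NextLeaf u v ∨ P.NextLeaf v u

/-- The set of colours on the edges incident with `v` in an edge colouring. -/
def colorsAt {V α : Type*} {G : SimpleGraph V} (c : G.lineGraph.Coloring α) (v : V) : Set α :=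
  {a | ∃ e : G.edgeSet, v ∈ (e : Sym2 V) ∧ c e = a}

/-- A proper edge colouring (a proper vertex colouring of the line graph) is
adjacent-vertex-distinguishing if the sets of colours at any two adjacent vertices differ. -/
def IsAVD {V α : Type*} {G : SimpleGraph V} (c : G.lineGraph.Coloring α) : Prop :=
  ∀ u v, G.Adj u v → colorsAt c u ≠ colorsAt c v

/-- The adjacent-vertex-distinguishing chromatic index: the least number of colours in an
adjacent-vertex-distinguishing edge colouring (`⊤` if there is none with finitely many). -/
noncomputable def avdChromaticIndex {V : Type*} (G : SimpleGraph V) : ℕ∞ :=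
  ⨅ k ∈ {k : ℕ | ∃ c : G.lineGraph.Coloring (Fin k), IsAVD c}, (k : ℕ∞)

/-- The cubic Halin graph `H₄`. The tree is the path `0, 1, 2, 3` with pendant leaves on one
side; the outer cycle is `4, 5, …, 9`. -/
def graphH4 : SimpleGraph (Fin 10) :=
  SimpleGraph.fromRel fun u v => (u, v) ∈
    ([(0, 1), (1, 2), (2, 3),
      (0, 4), (0, 5), (1, 6), (2, 7), (3, 8), (3, 9),
      (4, 5), (5, 6), (6, 7), (7, 8), (8, 9), (9, 4)] : List (Fin 10 × Fin 10))

/-- The cubic Halin graph `H₅`. The tree is the path `0, 1, 2, 3, 4` with pendant leaves on one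
side; the outer cycle is `5, 6, …, 11`. -/
def graphH5 : SimpleGraph (Fin 12) :=
  SimpleGraph.fromRel fun u v => (u, v) ∈
    ([(0, 1), (1, 2), (2, 3), (3, 4),
      (0, 5), (0, 6), (1, 7), (2, 8), (3, 9), (4, 10), (4, 11),
      (5, 6), (6, 7), (7, 8), (8, 9), (9, 10), (10, 11), (11, 5)] : List (Fin 12 × Fin 12))

/-- The cubic Halin graph `H₈`. The inner vertices of the tree are `0, …, 7`, where `1` is
joined to `0` and to the ends of the paths `2, 3, 4` and `5, 6, 7`; the outer cycle is
`8, 9, …, 17`. -/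
def graphH8 : SimpleGraph (Fin 18) :=
  SimpleGraph.fromRel fun u v => (u, v) ∈
    ([(1, 0), (1, 2), (2, 3), (3, 4), (1, 5), (5, 6), (6, 7),
      (0, 8), (0, 9), (2, 10), (3, 11), (4, 12), (4, 13), (7, 14), (7, 15), (6, 16), (5, 17),
      (8, 9), (9, 10), (10, 11), (11, 12), (12, 13), (13, 14), (14, 15), (15, 16), (16, 17),
      (17, 8)] : List (Fin 18 × Fin 18))

/-! Root the plane tree at one of its leaves `p`. What remains is a rooted plane tree with at most
two children at each vertex, and since the added cycle follows the boundary of the unique face, it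
runs through `p` and then through the leaves from left to right (`IsHalin.exists_tree`). A colouring
with four colours is recorded by a label at each vertex: the colour towards the parent, the colour
of the cycle edge entering from the left, and the missing colour (or, in degree two, the colour
towards the child). The AVD condition then becomes a condition on neighbouring labels, `Proper`
inside the tree and `ProperAt` at `p`, and `LTree.exists_isAVD` reads a colouring off such labels.

A subtree meets the rest of the graph only in the edge above its root and in the cycle edges at its
two ends. Hence six colours describe a colouring of it for all further purposes (`Realizes`),
together with whether its root has exactly one child. The colour above the root and the auxiliary
colour of the root differ, so a permutation of the colours makes them 0 and 1. What is left is a set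
of quadruples of colours, one of the subsets of a set of size 256, coded as a natural number.

The sets for the children yield a set for the parent (`Within.bin`, `Within.un`), and enlarging the
former only enlarges the latter. It is therefore enough to follow lower bounds: `table` is a finite
family such that whatever arises from its members contains a member again (`checkBin_eq`,
`checkUn_eq`). By induction every tree realizes all quadruples of some member (`exists_fits`). Trees
that occur inside the exceptional graphs are poor in colourings and have members of their own,
tagged with their exact shape. Every member either contains a quadruple that extends to `p` or is
tagged with an exceptional shape (`check_closing`), and the shape determines the graph up to
isomorphism (`LTree.nonempty_iso`).

For the lower bound, `p` and the next leaf are adjacent vertices of degree three; with at most three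
colours both would see every colour (`colorsAt_eq_univ`). -/

/-! ### Labelled rooted plane trees. -/

/-- A rooted plane tree in which every vertex has at most two children, with labelled vertices. -/
inductive LTree (α : Type*) : Type _
  | leaf (v : α) : LTree α
  | un (v : α) (t : LTree α) : LTree α
  | bin (v : α) (l r : LTree α) : LTree α

namespace LTree

variable {α β γ : Type*}

/-- The label of the root. -/
def root : LTree α → α
  | leaf v => v
  | un v _ => v
  | bin v _ _ => v

/-- The labels of all vertices, in preorder. -/
def verts : LTree α → List α
  | leaf v => [v]
  | un v t => v :: verts t
  | bin v l r => v :: (verts l ++ verts r)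

/-- The labels of the leaves, from left to right. -/
def leaves : LTree α → List α
  | leaf v => [v]
  | un _ t => leaves t
  | bin _ l r => leaves l ++ leaves r

/-- Relabel the vertices. -/
def map (f : α → β) : LTree α → LTree β
  | leaf v => leaf (f v)
  | un v t => un (f v) (map f t)
  | bin v l r => bin (f v) (map f l) (map f r)

/-- The leftmost leaf. -/
def first : LTree α → α
  | leaf v => v
  | un _ t => first t
  | bin _ l _ => first l

/-- The rightmost leaf. -/
def last : LTree α → α
  | leaf v => v
  | un _ t => last t
  | bin _ _ r => last r

/-- Whether the root has exactly one child. -/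
def isUn : LTree α → Bool
  | un _ _ => true
  | _ => false

/-- The unlabelled tree. -/
def shape (t : LTree α) : LTree Unit := t.map fun _ => ()

/-- The pairs (parent, child) in the tree that arises when the root gets the parent `p`. -/
def arcs (p : α) : LTree α → List (α × α)
  | leaf v => [(p, v)]
  | un v t => (p, v) :: arcs v t
  | bin v l r => (p, v) :: (arcs v l ++ arcs v r)

/-- The pairs of consecutive vertices on the cycle through `p` and the leaves of the tree. -/
def rim (p : α) (t : LTree α) : List (α × α) :=
  (p :: t.leaves).zip (t.leaves ++ [p])

@[simp] theorem root_map (f : α → β) (t : LTree α) : (t.map f).root = f t.root := by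
  cases t <;> rfl

@[simp] theorem first_map (f : α → β) (t : LTree α) : (t.map f).first = f t.first := by
  induction t <;> simp_all [map, first]

@[simp] theorem last_map (f : α → β) (t : LTree α) : (t.map f).last = f t.last := by
  induction t <;> simp_all [map, last]

@[simp] theorem isUn_map (f : α → β) (t : LTree α) : (t.map f).isUn = t.isUn := by
  cases t <;> rfl

theorem map_map (f : α → β) (g : β → γ) (t : LTree α) : (t.map f).map g = t.map (g ∘ f) := by
  induction t <;> simp_all [map]

@[simp] theorem shape_map (f : α → β) (t : LTree α) : (t.map f).shape = t.shape :=
  map_map _ _ _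

theorem map_congr {f g : α → β} (t : LTree α) (h : ∀ v ∈ t.verts, f v = g v) :
    t.map f = t.map g := by
  induction t <;> simp_all [map, verts]

@[simp] theorem verts_map (f : α → β) (t : LTree α) : (t.map f).verts = t.verts.map f := by
  induction t <;> simp_all [map, verts]

@[simp] theorem leaves_map (f : α → β) (t : LTree α) : (t.map f).leaves = t.leaves.map f := by
  induction t <;> simp_all [map, leaves]

theorem arcs_map (f : α → β) (p : α) (t : LTree α) :
    (t.map f).arcs (f p) = (t.arcs p).map (Prod.map f f) := by
  induction t generalizing p <;> simp_all [map, arcs]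

theorem rim_map (f : α → β) (p : α) (t : LTree α) :
    (t.map f).rim (f p) = (t.rim p).map (Prod.map f f) := by
  rw [rim, rim, ← List.zip_map]; simp

theorem root_mem_verts (t : LTree α) : t.root ∈ t.verts := by
  cases t <;> simp [root, verts]

theorem mem_verts_of_mem_leaves {t : LTree α} {v : α} (h : v ∈ t.leaves) : v ∈ t.verts := by
  induction t <;> simp_all [leaves, verts]; tauto

theorem root_arc_mem (p : α) (t : LTree α) : (p, t.root) ∈ t.arcs p := by
  cases t <;> simp [root, arcs]

theorem leaves_eq_cons (t : LTree α) : ∃ l, t.leaves = t.first :: l := by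
  induction t with
  | leaf v => exact ⟨[], rfl⟩
  | un v t ih => exact ih
  | bin v l r ihl ihr => obtain ⟨l', h⟩ := ihl; exact ⟨l' ++ r.leaves, by simp [leaves, first, h]⟩

theorem leaves_eq_concat (t : LTree α) : ∃ l, t.leaves = l ++ [t.last] := by
  induction t with
  | leaf v => exact ⟨[], rfl⟩
  | un v t ih => exact ih
  | bin v l r ihl ihr => obtain ⟨l', h⟩ := ihr; exact ⟨l.leaves ++ l', by simp [leaves, last, h]⟩

/-- A tree with distinct labels is mapped onto every tree of the same shape. -/
theorem exists_map_eq [Nonempty β] {t : LTree α} (ht : t.verts.Nodup) {s : LTree β}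
    (h : s.shape = t.shape) : ∃ f : α → β, t.map f = s := by
  classical
  induction t generalizing s with
  | leaf v =>
    cases s <;> simp only [shape, map, reduceCtorEq] at h
    rename_i w; exact ⟨fun _ => w, rfl⟩
  | un v t ih =>
    cases s <;> simp only [shape, map, reduceCtorEq, un.injEq, true_and] at h
    rename_i w s
    simp only [verts, List.nodup_cons] at ht
    obtain ⟨f, rfl⟩ := ih ht.2 h
    refine ⟨Function.update f v w, ?_⟩
    simp only [map, Function.update_self, un.injEq, true_and]
    exact map_congr _ fun x hx => Function.update_of_ne (by rintro rfl; exact ht.1 hx) _ _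
  | bin v l r ihl ihr =>
    cases s <;> simp only [shape, map, reduceCtorEq, bin.injEq, true_and] at h
    rename_i w s₁ s₂
    simp only [verts, List.nodup_cons, List.nodup_append, List.mem_append, not_or] at ht
    obtain ⟨⟨hl, hr⟩, nl, nr, disj⟩ := ht
    obtain ⟨f, rfl⟩ := ihl nl h.1
    obtain ⟨g, rfl⟩ := ihr nr h.2
    refine ⟨Function.update (fun x => if x ∈ l.verts then f x else g x) v w, ?_⟩
    simp only [map, Function.update_self, bin.injEq, true_and]
    constructor <;> apply map_congr <;> intro x hx
    · rw [Function.update_of_ne (by rintro rfl; exact hl hx), if_pos hx]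
    · rw [Function.update_of_ne (by rintro rfl; exact hr hx),
        if_neg fun hx' => disj x hx' x hx rfl]

end LTree

/-! ### The two sides of an edge of a tree. -/

namespace SimpleGraph

variable {V : Type*} {T : SimpleGraph V}

/-- The vertices that are closer to `v` than to `u`. -/
def side (T : SimpleGraph V) (u v : V) : Set V := {w | T.dist w v < T.dist w u}

theorem IsTree.not_mem_side_iff (hT : T.IsTree) {u v : V} (h : T.Adj u v) (w : V) :
    w ∉ T.side u v ↔ w ∈ T.side v u := by
  have := hT.dist_ne_of_adj w h
  simp only [side, Set.mem_ofPred_eq]; omega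

theorem mem_side_self {u v : V} (h : T.Adj u v) : v ∈ T.side u v := by
  simp [side, dist_eq_one_iff_adj.mpr h.symm]

theorem IsTree.exists_mem_side (hT : T.IsTree) {v w : V} (h : w ≠ v) :
    ∃ c, T.Adj v c ∧ w ∈ T.side v c := by
  obtain ⟨p, hp⟩ := (hT.connected v w).exists_walk_length_eq_dist
  cases p with
  | nil => exact absurd rfl h
  | @cons _ c _ hc p =>
    refine ⟨c, hc, ?_⟩
    have := dist_le p
    simp only [Walk.length_cons] at hp
    simp only [side, Set.mem_ofPred_eq, T.dist_comm (u := w)]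
    omega

/-- A step from `v` to a neighbour nearer to `w` extends to a geodesic, hence to a path. The path
from `v` to `w` is unique, and so is its second vertex. -/
theorem IsTree.eq_of_mem_side (hT : T.IsTree) {v c c' w : V} (hc : T.Adj v c) (hc' : T.Adj v c')
    (h : w ∈ T.side v c) (h' : w ∈ T.side v c') : c = c' := by
  have key : ∀ {c}, T.Adj v c → w ∈ T.side v c →
      ∀ p : T.Walk v w, p.IsPath → c = p.snd := by
    intro c hc h p hp
    obtain ⟨q, hq⟩ := (hT.connected c w).exists_walk_length_eq_dist
    have hd := hT.dist_eq_dist_add_one_of_adj w hc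
    simp only [side, Set.mem_ofPred_eq] at h
    have hq' : (Walk.cons hc q).IsPath := by
      apply Walk.isPath_of_length_eq_dist
      rw [Walk.length_cons, hq, T.dist_comm (u := c), T.dist_comm (u := v)]
      omega
    have : Walk.cons hc q = p := (hT.existsUnique_path v w).unique hq' hp
    rw [← this]; simp
  obtain ⟨p, hp, -⟩ := hT.existsUnique_path v w
  rw [key hc h p hp, key hc' h' p hp]

theorem IsTree.side_subset (hT : T.IsTree) {u v c : V} (hu : T.Adj u v) (hc : T.Adj v c)
    (h : c ≠ u) : T.side v c ⊆ T.side u v := by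
  intro w hw
  by_contra hw'
  exact h (hT.eq_of_mem_side hc hu.symm hw ((hT.not_mem_side_iff hu w).1 hw'))

theorem IsTree.side_ssubset (hT : T.IsTree) {u v c : V} (hu : T.Adj u v) (hc : T.Adj v c)
    (h : c ≠ u) : T.side v c ⊂ T.side u v :=
  (hT.side_subset hu hc h).ssubset_of_mem_notMem (mem_side_self hu)
    ((hT.not_mem_side_iff hc v).2 (mem_side_self hc.symm))

end SimpleGraph

/-! ### From the rotation system to a rooted tree and the order of its leaves. -/

namespace PlaneTree

variable {V : Type*} (P : PlaneTree V)

theorem faceStep_fst (d : P.graph.Dart) : (P.faceStep d).fst = d.snd := rfl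

/-- The dart `d` leads into the plane subtree `t`. -/
def LeadsTo : P.graph.Dart → LTree V → Prop
  | d, .leaf v => d.snd = v ∧ ∀ w, P.graph.Adj v w ↔ w = d.fst
  | d, .un v t => d.snd = v ∧ LeadsTo (P.faceStep d) t ∧ P.faceStep (P.faceStep d).symm = d.symm ∧
      t.root ≠ d.fst ∧ ∀ w, P.graph.Adj v w ↔ w = d.fst ∨ w = t.root
  | d, .bin v l r => d.snd = v ∧ LeadsTo (P.faceStep d) l ∧
      LeadsTo (P.faceStep (P.faceStep d).symm) r ∧
      P.faceStep (P.faceStep (P.faceStep d).symm).symm = d.symm ∧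
      l.root ≠ d.fst ∧ r.root ≠ d.fst ∧ l.root ≠ r.root ∧
      ∀ w, P.graph.Adj v w ↔ w = d.fst ∨ w = l.root ∨ w = r.root

variable {P}

theorem LeadsTo.snd_eq {d : P.graph.Dart} {t : LTree V} (h : P.LeadsTo d t) : d.snd = t.root := by
  cases t <;> exact h.1

-- A cyclic permutation of at most three neighbours has length one, two or three; these cases become
-- a leaf, a vertex with one child and a vertex with two children.
variable (P) in
theorem rot_cases (hdeg : ∀ v, (P.graph.neighborSet v).encard ≤ 3) (v : V)
    (a : P.graph.neighborSet v) :
    (∀ b, b = a) ∨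
    (P.rot v a ≠ a ∧ P.rot v (P.rot v a) = a ∧ ∀ b, b = a ∨ b = P.rot v a) ∨
    (P.rot v a ≠ a ∧ P.rot v (P.rot v a) ≠ a ∧ P.rot v (P.rot v a) ≠ P.rot v a ∧
      P.rot v (P.rot v (P.rot v a)) = a ∧
      ∀ b, b = a ∨ b = P.rot v a ∨ b = P.rot v (P.rot v a)) := by
  set σ := P.rot v
  have hfin : (P.graph.neighborSet v).Finite :=
    Set.finite_of_encard_le_coe (hdeg v)
  have := hfin.to_subtype
  have hpow : ∀ b, ∃ n : ℕ, (σ ^ n) a = b := fun b => by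
    obtain ⟨n, -, h⟩ := ((P.rot_isCycleOn v).2 (Set.mem_univ a) (Set.mem_univ b)).exists_pow_eq'
    exact ⟨n, h⟩
  by_cases h1 : σ a = a
  · left; intro b; obtain ⟨n, rfl⟩ := hpow b
    induction n with
    | zero => rfl
    | succ n ih => rw [pow_succ', Equiv.Perm.mul_apply, ih, h1]
  by_cases h2 : σ (σ a) = a
  · right; left; refine ⟨h1, h2, fun b => ?_⟩
    obtain ⟨n, rfl⟩ := hpow b
    induction n with
    | zero => left; rfl
    | succ n ih => rw [pow_succ', Equiv.Perm.mul_apply]; rcases ih with h | h <;> rw [h] <;> simp [h2]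
  have h12 : σ (σ a) ≠ σ a := fun h => h1 (σ.injective h)
  -- Otherwise the orbit of `a` starts with four distinct neighbours of `v`.
  have h3 : σ (σ (σ a)) = a := by
    by_contra h3
    have h31 : σ (σ (σ a)) ≠ σ a := fun h => h2 (σ.injective h)
    have h32 : σ (σ (σ a)) ≠ σ (σ a) := fun h => h12 (σ.injective h)
    have hsub : ({(a : V), (σ a : V), (σ (σ a) : V), (σ (σ (σ a)) : V)} : Set V) ⊆
        P.graph.neighborSet v := by
      rintro x (rfl | rfl | rfl | rfl) <;> exact Subtype.property _
    have hc := (Set.encard_le_encard hsub).trans (hdeg v)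
    rw [Set.encard_insert_of_notMem, Set.encard_insert_of_notMem,
      Set.encard_pair] at hc
    · exact absurd hc (by decide)
    · simpa [Subtype.ext_iff] using fun h => h32 (Subtype.ext h.symm)
    · simp only [Set.mem_insert_iff, Set.mem_singleton_iff, not_or, ← Subtype.ext_iff]
      exact ⟨fun h => h12 h.symm, fun h => h31 h.symm⟩
    · simp only [Set.mem_insert_iff, Set.mem_singleton_iff, not_or, ← Subtype.ext_iff]
      exact ⟨fun h => h1 h.symm, fun h => h2 h.symm, fun h => h3 h.symm⟩
  right; right; refine ⟨h1, h2, h12, h3, fun b => ?_⟩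
  obtain ⟨n, rfl⟩ := hpow b
  induction n with
  | zero => left; rfl
  | succ n ih =>
    rw [pow_succ', Equiv.Perm.mul_apply]; rcases ih with h | h | h <;> rw [h] <;> simp [h3]

/-- Induction on the number of vertices beyond the dart: each dart that continues away from its head
cuts off a strictly smaller side. -/
theorem exists_leadsTo [Finite V] (hdeg : ∀ v, (P.graph.neighborSet v).encard ≤ 3)
    (d : P.graph.Dart) : ∃ t, P.LeadsTo d t := by
  induction hn : (P.graph.side d.fst d.snd).ncard using Nat.strong_induction_on generalizing d with
  | _ n ih =>
    subst hn
    have step : ∀ e : P.graph.Dart, e.fst = d.snd → e.snd ≠ d.fst → ∃ t, P.LeadsTo e t := by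
      intro e he he'
      refine ih _ (Set.ncard_lt_ncard ?_ (Set.toFinite _)) e rfl
      obtain ⟨⟨a, b⟩, hab⟩ := e
      dsimp only at he; subst he
      exact P.isTree.side_ssubset d.adj hab he'
    obtain ⟨⟨u, v⟩, huv⟩ := d
    have huv' : P.graph.Adj u v := huv
    rcases P.rot_cases hdeg v ⟨u, huv'.symm⟩ with h | ⟨h1, h2, h⟩ | ⟨h1, h2, h12, h3, h⟩
    · exact ⟨.leaf v, rfl, fun w => ⟨fun hw => congrArg Subtype.val (h ⟨w, hw⟩),
        fun hw => hw ▸ huv'.symm⟩⟩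
    · obtain ⟨t, ht⟩ := step (P.faceStep ⟨(u, v), huv⟩) rfl fun e => h1 (Subtype.ext e)
      refine ⟨.un v t, rfl, ht, ?_, ?_, ?_⟩
      · apply SimpleGraph.Dart.ext
        exact Prod.ext rfl (congrArg Subtype.val h2)
      · rw [← ht.snd_eq]; exact fun e => h1 (Subtype.ext e)
      · intro w
        rw [← ht.snd_eq]
        constructor
        · exact fun hw => (h ⟨w, hw⟩).imp (congrArg Subtype.val) (congrArg Subtype.val)
        · rintro (rfl | rfl)
          · exact huv'.symm
          · exact Subtype.property _
    · obtain ⟨l, hl⟩ := step (P.faceStep ⟨(u, v), huv⟩) rfl fun e => h1 (Subtype.ext e)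
      obtain ⟨r, hr⟩ := step (P.faceStep (P.faceStep ⟨(u, v), huv⟩).symm) rfl
        fun e => h2 (Subtype.ext e)
      refine ⟨.bin v l r, rfl, hl, hr, ?_, ?_, ?_, ?_, ?_⟩
      · apply SimpleGraph.Dart.ext
        exact Prod.ext rfl (congrArg Subtype.val h3)
      · rw [← hl.snd_eq]; exact fun e => h1 (Subtype.ext e)
      · rw [← hr.snd_eq]; exact fun e => h2 (Subtype.ext e)
      · rw [← hl.snd_eq, ← hr.snd_eq]; exact fun e => h12 (Subtype.ext e.symm)
      · intro w
        rw [← hl.snd_eq, ← hr.snd_eq]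
        constructor
        · exact fun hw => (h ⟨w, hw⟩).imp (congrArg Subtype.val)
            (Or.imp (congrArg Subtype.val) (congrArg Subtype.val))
        · rintro (rfl | rfl | rfl)
          · exact huv'.symm
          · exact Subtype.property _
          · exact Subtype.property _

theorem LeadsTo.mem_verts {d : P.graph.Dart} {t : LTree V} (h : P.LeadsTo d t) (w : V) :
    w ∈ t.verts ↔ w ∈ P.graph.side d.fst d.snd := by
  have hT := P.isTree
  induction t generalizing d with
  | leaf v =>
    obtain ⟨rfl, hv⟩ := h
    simp only [LTree.verts, List.mem_singleton]
    refine ⟨by rintro rfl; exact SimpleGraph.mem_side_self d.adj, fun hw => ?_⟩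
    by_contra hne
    obtain ⟨c, hc, hwc⟩ := hT.exists_mem_side hne
    rw [hv] at hc; subst hc
    exact (hT.not_mem_side_iff d.adj w).2 hwc hw
  | un v t ih =>
    obtain ⟨rfl, ht, -, hne, hv⟩ := h
    simp only [LTree.verts, List.mem_cons, ih ht]
    rw [ht.snd_eq, faceStep_fst]
    constructor
    · rintro (rfl | hw)
      · exact SimpleGraph.mem_side_self d.adj
      · exact hT.side_subset d.adj ((hv _).2 (.inr rfl)) hne hw
    · intro hw
      by_contra! hcon
      obtain ⟨c, hc, hwc⟩ := hT.exists_mem_side hcon.1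
      rcases (hv c).1 hc with rfl | rfl
      · exact (hT.not_mem_side_iff d.adj w).2 hwc hw
      · exact hcon.2 hwc
  | bin v l r ihl ihr =>
    obtain ⟨rfl, hl, hr, -, hne, hne', -, hv⟩ := h
    simp only [LTree.verts, List.mem_cons, List.mem_append, ihl hl, ihr hr]
    rw [hl.snd_eq, hr.snd_eq, faceStep_fst, faceStep_fst]
    change _ ∨ _ ∨ w ∈ P.graph.side d.snd _ ↔ _
    constructor
    · rintro (rfl | hw | hw)
      · exact SimpleGraph.mem_side_self d.adj
      · exact hT.side_subset d.adj ((hv _).2 (.inr (.inl rfl))) hne hw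
      · exact hT.side_subset d.adj ((hv _).2 (.inr (.inr rfl))) hne' hw
    · intro hw
      by_contra! hcon
      obtain ⟨c, hc, hwc⟩ := hT.exists_mem_side hcon.1
      rcases (hv c).1 hc with rfl | rfl | rfl
      · exact (hT.not_mem_side_iff d.adj w).2 hwc hw
      · exact hcon.2.1 hwc
      · exact hcon.2.2 hwc

theorem LeadsTo.nodup {d : P.graph.Dart} {t : LTree V} (h : P.LeadsTo d t) : t.verts.Nodup := by
  have hT := P.isTree
  have hself : ∀ {v c : V}, P.graph.Adj v c → v ∉ P.graph.side v c := fun hc =>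
    (hT.not_mem_side_iff hc _).2 (SimpleGraph.mem_side_self hc.symm)
  induction t generalizing d with
  | leaf v => simp [LTree.verts]
  | un v t ih =>
    obtain ⟨rfl, ht, -, hne, hv⟩ := h
    simp only [LTree.verts, List.nodup_cons, ih ht, ht.mem_verts, and_true]
    exact hself (P.faceStep d).adj
  | bin v l r ihl ihr =>
    obtain ⟨rfl, hl, hr, -, hne, hne', hlr, hv⟩ := h
    simp only [LTree.verts, List.nodup_cons, List.nodup_append, List.mem_append, ihl hl, ihr hr,
      hl.mem_verts, hr.mem_verts, not_or, true_and]
    refine ⟨⟨hself (P.faceStep d).adj, hself (P.faceStep (P.faceStep d).symm).adj⟩, ?_⟩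
    rintro a ha _ hb rfl
    rw [hl.snd_eq, faceStep_fst] at ha
    rw [hr.snd_eq, faceStep_fst] at hb
    exact hlr (hT.eq_of_mem_side ((hv _).2 (.inr (.inl rfl))) ((hv _).2 (.inr (.inr rfl))) ha hb)

theorem LeadsTo.adj_of_mem_arcs {d : P.graph.Dart} {t : LTree V} (h : P.LeadsTo d t) {x y : V}
    (hxy : (x, y) ∈ t.arcs d.fst) : P.graph.Adj x y := by
  induction t generalizing d with
  | leaf v =>
    obtain ⟨rfl, -⟩ := h
    simp only [LTree.arcs, List.mem_singleton, Prod.mk.injEq] at hxy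
    rw [hxy.1, hxy.2]; exact d.adj
  | un v t ih =>
    obtain ⟨rfl, ht, -⟩ := h
    simp only [LTree.arcs, List.mem_cons, Prod.mk.injEq] at hxy
    rcases hxy with ⟨rfl, rfl⟩ | hxy
    · exact d.adj
    · exact ih ht hxy
  | bin v l r ihl ihr =>
    obtain ⟨rfl, hl, hr, -⟩ := h
    simp only [LTree.arcs, List.mem_cons, List.mem_append, Prod.mk.injEq] at hxy
    rcases hxy with ⟨rfl, rfl⟩ | hxy | hxy
    · exact d.adj
    · exact ihl hl hxy
    · exact ihr hr hxy

theorem LeadsTo.mem_arcs_of_adj {d : P.graph.Dart} {t : LTree V} (h : P.LeadsTo d t) {x y : V}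
    (hx : x ∈ t.verts) (hxy : P.graph.Adj x y) :
    (x, y) ∈ t.arcs d.fst ∨ (y, x) ∈ t.arcs d.fst := by
  induction t generalizing d with
  | leaf v =>
    obtain ⟨rfl, hv⟩ := h
    simp only [LTree.verts, List.mem_singleton] at hx; subst hx
    right; simp [LTree.arcs, (hv y).1 hxy]
  | un v t ih =>
    obtain ⟨rfl, ht, -, -, hv⟩ := h
    simp only [LTree.verts, List.mem_cons] at hx
    simp only [LTree.arcs, List.mem_cons]
    rcases hx with rfl | hx
    · rcases (hv y).1 hxy with rfl | rfl
      · simp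
      · exact .inl (.inr (LTree.root_arc_mem _ _))
    · exact (ih ht hx).imp .inr .inr
  | bin v l r ihl ihr =>
    obtain ⟨rfl, hl, hr, -, -, -, -, hv⟩ := h
    simp only [LTree.verts, List.mem_cons, List.mem_append] at hx
    simp only [LTree.arcs, List.mem_cons, List.mem_append]
    rcases hx with rfl | hx | hx
    · rcases (hv y).1 hxy with rfl | rfl | rfl
      · simp
      · exact .inl (.inr (.inl (LTree.root_arc_mem _ _)))
      · exact .inl (.inr (.inr (LTree.root_arc_mem _ _)))
    · exact (ihl hl hx).imp (fun h => .inr (.inl h)) fun h => .inr (.inl h)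
    · exact (ihr hr hx).imp (fun h => .inr (.inr h)) fun h => .inr (.inr h)

theorem LeadsTo.isLeaf_iff {d : P.graph.Dart} {t : LTree V} (h : P.LeadsTo d t) {x : V}
    (hx : x ∈ t.verts) : P.IsLeaf x ↔ x ∈ t.leaves := by
  have two : ∀ {v a b}, P.graph.Adj v a → P.graph.Adj v b → a ≠ b → ¬ P.IsLeaf v :=
    fun ha hb hab hv => hab (hv.unique ha hb)
  induction t generalizing d with
  | leaf v =>
    obtain ⟨rfl, hv⟩ := h
    simp only [LTree.verts, List.mem_singleton] at hx; subst hx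
    simp only [LTree.leaves, List.mem_singleton, iff_true]
    exact ⟨d.fst, (hv _).2 rfl, fun w => (hv w).1⟩
  | un v t ih =>
    obtain ⟨rfl, ht, -, hne, hv⟩ := h
    have hnot : ¬ P.IsLeaf d.snd := two ((hv _).2 (.inl rfl)) ((hv _).2 (.inr rfl)) hne.symm
    by_cases hx' : x ∈ t.verts
    · exact ih ht hx'
    · simp only [LTree.verts, List.mem_cons, hx', or_false] at hx
      subst hx
      exact iff_of_false hnot fun h => hx' (LTree.mem_verts_of_mem_leaves h)
  | bin v l r ihl ihr =>
    have hnd := h.nodup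
    obtain ⟨rfl, hl, hr, -, hne, -, -, hv⟩ := h
    have hnot : ¬ P.IsLeaf d.snd := two ((hv _).2 (.inl rfl)) ((hv _).2 (.inr (.inl rfl))) hne.symm
    simp only [LTree.verts, List.nodup_cons, List.nodup_append, List.mem_append] at hnd
    simp only [LTree.leaves, List.mem_append]
    simp only [LTree.verts, List.mem_cons, List.mem_append] at hx
    rcases hx with rfl | hx | hx
    · exact iff_of_false hnot fun h => hnd.1 (h.imp LTree.mem_verts_of_mem_leaves
        LTree.mem_verts_of_mem_leaves)
    · refine (ihl hl hx).trans ?_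
      exact ⟨.inl, fun h => h.resolve_right fun h' =>
        hnd.2.2.2 x hx x (LTree.mem_verts_of_mem_leaves h') rfl⟩
    · refine (ihr hr hx).trans ?_
      exact ⟨.inr, fun h => h.resolve_left fun h' =>
        hnd.2.2.2 x (LTree.mem_verts_of_mem_leaves h') x hx rfl⟩

variable (P) in
/-- The face-boundary walk goes from the dart `d` to the dart `e` by passing through inner
vertices only. -/
def PassesTo : P.graph.Dart → P.graph.Dart → Prop :=
  Relation.ReflTransGen fun d e => ¬ P.IsLeaf d.snd ∧ P.faceStep d = e

variable (P) in
/-- The face-boundary walk from the dart `d` to the dart `e` turns around at the listed leaves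
and at no other leaves in between. -/
def Traverses : P.graph.Dart → List V → P.graph.Dart → Prop
  | d, [], e => P.PassesTo d e
  | d, x :: xs, e => ∃ d' e', P.PassesTo d d' ∧ d'.snd = x ∧ P.IsLeaf x ∧ e'.fst = x ∧
      Traverses e' xs e

theorem Traverses.step_left {d d' e : P.graph.Dart} {xs : List V} (h : P.Traverses d' xs e)
    (hd : ¬ P.IsLeaf d.snd) (hd' : P.faceStep d = d') : P.Traverses d xs e := by
  cases xs with
  | nil => exact Relation.ReflTransGen.head ⟨hd, hd'⟩ h
  | cons x xs =>
    obtain ⟨f, f', hf, rest⟩ := h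
    exact ⟨f, f', Relation.ReflTransGen.head ⟨hd, hd'⟩ hf, rest⟩

theorem Traverses.append {d e f : P.graph.Dart} {xs ys : List V} (h : P.Traverses d xs e)
    (h' : P.Traverses e ys f) : P.Traverses d (xs ++ ys) f := by
  induction xs generalizing d with
  | nil =>
    cases ys with
    | nil => exact Relation.ReflTransGen.trans h h'
    | cons y ys =>
      obtain ⟨a, b, ha, rest⟩ := h'
      exact ⟨a, b, Relation.ReflTransGen.trans h ha, rest⟩
  | cons x xs ih =>
    obtain ⟨a, b, ha, ha', hx, hb, rest⟩ := h
    exact ⟨a, b, ha, ha', hx, hb, ih rest⟩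

/-- The face walk that enters a subtree goes around it, turns at its leaves from left to right, and
comes back along the reversed dart. This identifies the order of the leaves along the face with the
order in the rooted tree. -/
theorem LeadsTo.traverses {d : P.graph.Dart} {t : LTree V} (h : P.LeadsTo d t) :
    P.Traverses d t.leaves d.symm := by
  have two : ∀ {v a b}, P.graph.Adj v a → P.graph.Adj v b → a ≠ b → ¬ P.IsLeaf v :=
    fun ha hb hab hv => hab (hv.unique ha hb)
  induction t generalizing d with
  | leaf v =>
    obtain ⟨rfl, hv⟩ := h
    exact ⟨d, d.symm, .refl, rfl, ⟨d.fst, (hv _).2 rfl, fun w => (hv w).1⟩, rfl, .refl⟩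
  | un v t ih =>
    obtain ⟨rfl, ht, hback, hne, hv⟩ := h
    have hnot : ¬ P.IsLeaf d.snd := two ((hv _).2 (.inl rfl)) ((hv _).2 (.inr rfl)) hne.symm
    have := (ih ht).step_left hnot rfl
    have h2 : P.Traverses (P.faceStep d).symm [] d.symm := .single ⟨hnot, hback⟩
    simpa [LTree.leaves] using this.append h2
  | bin v l r ihl ihr =>
    obtain ⟨rfl, hl, hr, hback, hne, -, -, hv⟩ := h
    have hnot : ¬ P.IsLeaf d.snd := two ((hv _).2 (.inl rfl)) ((hv _).2 (.inr (.inl rfl))) hne.symm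
    have h1 := (ihl hl).step_left hnot rfl
    have h2 := (ihr hr).step_left (d := (P.faceStep d).symm) hnot rfl
    have h3 : P.Traverses (P.faceStep (P.faceStep d).symm).symm [] d.symm :=
      .single ⟨hnot, hback⟩
    simpa [LTree.leaves] using h1.append (h2.append h3)

theorem PassesTo.nextLeaf {d e : P.graph.Dart} (h : P.PassesTo d e) (hd : P.IsLeaf d.fst)
    (he : P.IsLeaf e.snd) : P.NextLeaf d.fst e.snd := by
  refine ⟨hd, he, d, ?_⟩
  suffices ∃ n, P.faceStep^[n] d = e ∧ ∀ k < n, ¬ P.IsLeaf (P.faceStep^[k] d).snd by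
    obtain ⟨n, hn, h⟩ := this
    exact ⟨n, rfl, by rw [hn], h⟩
  clear hd he
  induction h with
  | refl => exact ⟨0, rfl, by simp⟩
  | tail _ hbc ih =>
    obtain ⟨n, rfl, hn⟩ := ih
    refine ⟨n + 1, by rw [Function.iterate_succ_apply', hbc.2], fun k hk => ?_⟩
    rcases Nat.lt_succ_iff_lt_or_eq.1 hk with hk | rfl
    · exact hn k hk
    · exact hbc.1

/-- Only one dart starts at a leaf, the walk is deterministic, and the first leaf that it meets is
therefore determined. -/
theorem NextLeaf.unique {u v w : V} (hv : P.NextLeaf u v) (hw : P.NextLeaf u w) : v = w := by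
  obtain ⟨hu, hv', d, n, rfl, rfl, hn⟩ := hv
  obtain ⟨-, hw', e, m, he, rfl, hm⟩ := hw
  have : e = d := by
    apply SimpleGraph.Dart.ext
    exact Prod.ext he (hu.unique (by simpa [he] using e.adj) d.adj)
  subst this
  rcases lt_trichotomy n m with h | rfl | h
  · exact absurd hv' (hm n h)
  · rfl
  · exact absurd hw' (hn m h)

theorem Traverses.nextLeaf {d e : P.graph.Dart} {xs : List V} (h : P.Traverses d xs e)
    (hd : P.IsLeaf d.fst) (he : P.IsLeaf e.snd) {p q : V}
    (hpq : (p, q) ∈ (d.fst :: xs).zip (xs ++ [e.snd])) : P.NextLeaf p q := by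
  induction xs generalizing d with
  | nil =>
    simp only [List.nil_append, List.zip_cons_cons, List.zip_nil_left, List.mem_singleton,
      Prod.mk.injEq] at hpq
    rw [hpq.1, hpq.2]; exact PassesTo.nextLeaf h hd he
  | cons x xs ih =>
    obtain ⟨a, b, ha, rfl, hx, hb, rest⟩ := h
    simp only [List.cons_append, List.zip_cons_cons, List.mem_cons, Prod.mk.injEq] at hpq
    rcases hpq with ⟨rfl, rfl⟩ | hpq
    · exact ha.nextLeaf hd hx
    · rw [← hb] at hpq hx
      exact ih rest hx hpq

end PlaneTree

/-- A subcubic Halin graph consists of a tree that is rooted at a leaf, and of the cycle through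
the leaves. -/
theorem IsHalin.exists_tree {V : Type*} [Finite V] {G : SimpleGraph V} (hG : IsHalin G)
    (hdeg : ∀ v, (G.neighborSet v).encard ≤ 3) :
    ∃ (p : V) (t : LTree V), (p :: t.verts).Nodup ∧ (∀ v, v ∈ p :: t.verts) ∧
      2 ≤ t.leaves.length ∧
      ∀ u v, G.Adj u v ↔ (u, v) ∈ t.arcs p ++ t.rim p ∨ (v, u) ∈ t.arcs p ++ t.rim p := by
  obtain ⟨P, h3, hadj⟩ := hG
  have hdeg' : ∀ v, (P.graph.neighborSet v).encard ≤ 3 := fun v =>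
    (Set.encard_le_encard fun w hw => (hadj v w).2 (.inl hw)).trans (hdeg v)
  obtain ⟨p, hp⟩ : ∃ p, P.IsLeaf p := by
    by_contra! hcon
    simp [hcon] at h3
  obtain ⟨w, hw, hpw⟩ := id hp
  let d : P.graph.Dart := ⟨(p, w), hw⟩
  obtain ⟨t, ht⟩ := P.exists_leadsTo hdeg' d
  have hroot : w = t.root := ht.snd_eq
  have hpt : p ∉ t.verts := by
    rw [ht.mem_verts]
    exact (P.isTree.not_mem_side_iff hw p).2 (SimpleGraph.mem_side_self hw.symm)
  have hall : ∀ v, v ∈ p :: t.verts := by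
    intro v
    rw [List.mem_cons, ht.mem_verts]
    by_contra! hcon
    obtain ⟨c, hc, hvc⟩ := P.isTree.exists_mem_side hcon.1
    have := hpw c hc
    subst this
    exact hcon.2 hvc
  have hleaf : ∀ v, P.IsLeaf v ↔ v ∈ p :: t.leaves := by
    intro v
    rcases List.mem_cons.1 (hall v) with rfl | hv
    · simp [hp]
    · rw [ht.isLeaf_iff hv, List.mem_cons, or_iff_right]
      rintro rfl; exact hpt hv
  have htree : ∀ u v, P.graph.Adj u v ↔ (u, v) ∈ t.arcs p ∨ (v, u) ∈ t.arcs p := by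
    intro u v
    refine ⟨fun h => ?_, fun h => h.elim ht.adj_of_mem_arcs fun h => (ht.adj_of_mem_arcs h).symm⟩
    rcases List.mem_cons.1 (hall u) with rfl | hu
    · rw [hpw v h, hroot]; exact .inl (LTree.root_arc_mem _ _)
    · exact ht.mem_arcs_of_adj hu h
  have hrim : ∀ u v, P.NextLeaf u v ↔ (u, v) ∈ t.rim p := by
    have back : ∀ {u v}, (u, v) ∈ t.rim p → P.NextLeaf u v := fun h =>
      ht.traverses.nextLeaf hp hp h
    -- Every leaf starts some pair of the rim, which gives it a successor; uniqueness of the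
    -- successor yields the converse.
    refine fun u v => ⟨fun h => ?_, back⟩
    have hu := (hleaf u).1 h.1
    have hfst : (t.rim p).map Prod.fst = p :: t.leaves := by
      rw [LTree.rim, List.map_fst_zip]; simp
    rw [← hfst, List.mem_map] at hu
    obtain ⟨⟨u', v'⟩, hmem, rfl⟩ := hu
    rw [h.unique (back hmem)]; exact hmem
  refine ⟨p, t, List.nodup_cons.2 ⟨hpt, ht.nodup⟩, hall, ?_, fun u v => ?_⟩
  · by_contra hlt
    classical
    have : {v | P.IsLeaf v} = ((p :: t.leaves).toFinset : Set V) := by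
      ext v; simp [hleaf]
    rw [this, Set.encard_coe_eq_coe_finsetCard] at h3
    have h3' : 3 ≤ (p :: t.leaves).toFinset.card := by exact_mod_cast h3
    have := (p :: t.leaves).toFinset_card_le
    simp only [List.length_cons] at this
    omega
  · rw [hadj, htree, hrim, hrim]
    simp only [List.mem_append]
    tauto

/-! ### From local colour data to AVD colourings. -/

/-- The list at a vertex enumerates its incident edges by neighbour and colour. Distinct neighbours
make the colour of an edge well defined, and distinct colours make the colouring proper. -/
theorem exists_isAVD_of_stars {V α : Type*} {G : SimpleGraph V} (K : V → V → α → Prop)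
    (hsymm : ∀ u v k, K u v k → K v u k) (hadj : ∀ u v, G.Adj u v ↔ ∃ k, K u v k)
    (hstar : ∀ v, ∃ L : List (V × α), (∀ y k, K v y k ↔ (y, k) ∈ L) ∧
      (L.map Prod.fst).Nodup ∧ (L.map Prod.snd).Nodup)
    (havd : ∀ u v, G.Adj u v → {k | ∃ y, K u y k} ≠ {k | ∃ y, K v y k}) :
    ∃ c : G.lineGraph.Coloring α, IsAVD c ∧ ∀ v, colorsAt c v = {k | ∃ y, K v y k} := by
  have h1 : ∀ {v y k k'}, K v y k → K v y k' → k = k' := by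
    intro v y k k' h h'
    obtain ⟨L, hL, hn, -⟩ := hstar v
    have := List.inj_on_of_nodup_map hn ((hL _ _).1 h) ((hL _ _).1 h') rfl
    exact congrArg Prod.snd this
  have h2 : ∀ {v y y' k}, K v y k → K v y' k → y = y' := by
    intro v y y' k h h'
    obtain ⟨L, hL, -, hn⟩ := hstar v
    have := List.inj_on_of_nodup_map hn ((hL _ _).1 h) ((hL _ _).1 h') rfl
    exact congrArg Prod.fst this
  have hex : ∀ e : G.edgeSet, ∃ k, ∀ u v, (e : Sym2 V) = s(u, v) → K u v k := by
    rintro ⟨e, he⟩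
    induction e using Sym2.ind with
    | _ x y =>
      obtain ⟨k, hk⟩ := (hadj x y).1 he
      refine ⟨k, fun u v huv => ?_⟩
      rcases Sym2.eq_iff.1 huv with ⟨rfl, rfl⟩ | ⟨rfl, rfl⟩
      · exact hk
      · exact hsymm _ _ _ hk
  choose c hc using hex
  have hcol : ∀ v, {a | ∃ e : G.edgeSet, v ∈ (e : Sym2 V) ∧ c e = a} = {k | ∃ y, K v y k} := by
    intro v; ext k; constructor
    · rintro ⟨e, hv, rfl⟩
      obtain ⟨y, hy⟩ := hv
      exact ⟨y, hc e v y hy⟩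
    · rintro ⟨y, hy⟩
      let e : G.edgeSet := ⟨s(v, y), (hadj v y).2 ⟨k, hy⟩⟩
      exact ⟨e, Sym2.mem_mk_left _ _, h1 (hc e v y rfl) hy⟩
  refine ⟨⟨c, fun {e e'} h heq => ?_⟩, fun u v huv => ?_, hcol⟩
  · obtain ⟨hne, v, ⟨y, hy⟩, ⟨y', hy'⟩⟩ := SimpleGraph.lineGraph_adj_iff_exists.1 h
    have hk := hc e v y hy
    have hk' := hc e' v y' hy'
    rw [heq] at hk
    exact hne (Subtype.ext (by rw [hy, hy', h2 hk hk']))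
  · have := havd u v huv
    rwa [← hcol, ← hcol] at this

/-- The colours around a vertex of a coloured tree: the colours of the edge to the parent and, at
a leaf, of the cycle edge that enters from the left; the colour that is missing at the vertex or,
at a vertex with exactly one child, the colour of the edge to the child. -/
structure Lab where
  arc : Fin 4
  rim : Fin 4
  aux : Fin 4
  un : Bool

/-- The colours of the edges at a vertex. -/
def Lab.palette (a : Lab) : Set (Fin 4) := if a.un then {a.arc, a.aux} else {a.aux}ᶜ

/-- The palette of the child is different from that of the parent. -/
def Lab.Compat (a b : Lab) : Prop :=
  (a.un = true → b.un = true → a.arc ≠ b.aux) ∧ (a.un = false → b.un = false → a.aux ≠ b.aux)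

/-- Palettes of sizes two and three differ anyway, and palettes of size three differ exactly when
the missing colours do. Two adjacent vertices of degree two share the colour of their common edge,
so only the other two colours need comparing. -/
theorem Lab.Compat.palette_ne {a b : Lab} (h : a.Compat b)
    (hab : a.un = true → a.arc ≠ a.aux ∧ a.aux = b.arc) : a.palette ≠ b.palette := by
  have aux : ∀ x y z : Fin 4, ({x, y} : Set (Fin 4)) ≠ {z}ᶜ := by
    intro x y z he
    obtain ⟨w, h1, h2, h3⟩ : ∃ w, w ≠ x ∧ w ≠ y ∧ w ≠ z := by clear he; revert x y z; decide
    have : w ∈ ({x, y} : Set (Fin 4)) := he ▸ h3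
    simp [h1, h2] at this
  unfold Lab.palette
  cases ha : a.un <;> cases hb : b.un <;> simp only [if_true, Bool.false_eq_true, if_false]
  · intro he
    exact h.2 ha hb (by simpa using he)
  · exact (aux _ _ _).symm
  · exact aux _ _ _
  · intro he
    obtain ⟨h1, h2⟩ := hab ha
    have : a.arc ∈ ({b.arc, b.aux} : Set (Fin 4)) := by rw [← he]; simp
    rcases this with h3 | h3
    · exact h1 (h3.trans h2.symm)
    · exact h.1 ha hb h3

namespace LTree

variable {α V : Type*}

/-- The colours in a tree are those of an AVD colouring, where the cycle edge that leaves the last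
leaf has the colour `c`. -/
def Proper (c : Fin 4) : LTree Lab → Prop
  | leaf a => a.un = false ∧ [a.arc, a.rim, c, a.aux].Nodup
  | un a t => a.un = true ∧ a.arc ≠ a.aux ∧ a.aux = t.root.arc ∧ a.Compat t.root ∧ Proper c t
  | bin a l r => a.un = false ∧ [a.arc, l.root.arc, r.root.arc, a.aux].Nodup ∧
      a.Compat l.root ∧ a.Compat r.root ∧ l.last.aux ≠ r.first.aux ∧
      Proper r.first.rim l ∧ Proper c r

/-- The colours in a tree together with a leaf with the label `a` as the parent of its root are
those of an AVD colouring. -/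
def ProperAt (a : Lab) (t : LTree Lab) : Prop :=
  a.un = false ∧ [a.rim, t.root.arc, t.first.rim, a.aux].Nodup ∧ a.Compat t.root ∧
    a.aux ≠ t.first.aux ∧ t.last.aux ≠ a.aux ∧ t.Proper a.rim

/-- The pairs of consecutive vertices in the list of `q` and the leaves. -/
def steps (q : α) : LTree α → List (α × α)
  | leaf v => [(q, v)]
  | un _ t => steps q t
  | bin _ l r => steps q l ++ steps l.last r

theorem rim_eq (p : α) (t : LTree α) : t.rim p = t.steps p ++ [(t.last, p)] := by
  suffices ∀ q ys s, (q :: (t.leaves ++ ys)).zip (t.leaves ++ (ys ++ [s])) =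
      t.steps q ++ (t.last :: ys).zip (ys ++ [s]) by simpa [rim] using this p [] p
  induction t with
  | leaf v => simp [leaves, steps, last]
  | un v t ih => exact ih
  | bin v l r ihl ihr =>
    intro q ys s
    have h := ihl q (r.leaves ++ ys) s
    simp only [List.append_assoc] at h
    simp only [leaves, List.append_assoc, h, ihr, steps, last]

theorem first_mem (t : LTree α) : t.first ∈ t.leaves := by
  obtain ⟨l, h⟩ := t.leaves_eq_cons; simp [h]

theorem last_mem (t : LTree α) : t.last ∈ t.leaves := by
  obtain ⟨l, h⟩ := t.leaves_eq_concat; simp [h]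

theorem steps_snd_mem {q x y : α} {t : LTree α} (h : (x, y) ∈ t.steps q) : y ∈ t.leaves := by
  induction t generalizing q <;> grind [steps, leaves]

theorem steps_fst_mem {q x y : α} {t : LTree α} (h : (x, y) ∈ t.steps q) :
    x ∈ t.leaves ∨ x = q ∧ y = t.first := by
  induction t generalizing q with
  | leaf v => simp_all [steps, leaves, first]
  | un v t ih => exact ih h
  | bin v l r ihl ihr =>
    have := l.last_mem
    simp only [steps, List.mem_append] at h
    simp only [leaves, first, List.mem_append]
    rcases h with h | h
    · have := ihl h; tauto
    · have := ihr h; grind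

theorem first_step_mem (q : α) (t : LTree α) : (q, t.first) ∈ t.steps q := by
  induction t generalizing q <;> simp_all [steps, first]

theorem arcs_snd_mem {p x y : α} {t : LTree α} (h : (x, y) ∈ t.arcs p) : y ∈ t.verts := by
  induction t generalizing p <;> grind [arcs, verts]

theorem arcs_fst_mem {p x y : α} {t : LTree α} (h : (x, y) ∈ t.arcs p) :
    x ∈ t.verts ∨ x = p ∧ y = t.root := by
  induction t generalizing p <;> grind [arcs, verts, root, root_mem_verts]

/-- The neighbours before and after the segment of leaves are arbitrary vertices `q` and `s`,
because in the induction each child's segment borders on a leaf of its sibling. The two cycle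
neighbours can coincide only when a single leaf lies between `q = s` on both sides. -/
theorem rim_star (f : V → Lab) {q s : V} {t : LTree V} (hnd : t.leaves.Nodup) (hq : q ∉ t.leaves)
    (hs : s ∉ t.leaves) (hf : (t.map f).Proper (f s).rim) {v : V} (hv : v ∈ t.leaves) :
    ∃ x y, (∀ z, (z, v) ∈ t.steps q ++ [(t.last, s)] ↔ z = x) ∧
      (∀ z, (v, z) ∈ t.steps q ++ [(t.last, s)] ↔ z = y) ∧
      (x = y → x = q ∧ y = s ∧ t.leaves.length = 1) ∧ (f v).un = false ∧
      [(f v).arc, (f v).rim, (f y).rim, (f v).aux].Nodup := by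
  induction t generalizing q s with
  | leaf w =>
    simp only [leaves, List.mem_singleton] at hv hs hq; subst hv
    refine ⟨q, s, fun z => ?_, fun z => ?_, fun _ => ⟨rfl, rfl, rfl⟩, hf⟩
    · simp [steps, last]; grind
    · simp [steps, last]; grind
  | un w t ih => exact ih hnd hq hs hf.2.2.2.2 hv
  | bin w l r ihl ihr =>
    obtain ⟨-, -, -, -, -, hl, hr⟩ := hf
    simp only [leaves, List.nodup_append, List.mem_append, not_or] at hnd hq hs hv ⊢
    obtain ⟨nl, nr, disj⟩ := hnd
    have d1 : r.first ∉ l.leaves := fun h => disj _ h _ r.first_mem rfl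
    have d2 : l.last ∉ r.leaves := fun h => disj _ l.last_mem _ h rfl
    have e1 := r.first_mem
    have e2 := r.last_mem
    have e3 := l.last_mem
    have e4 := r.first_step_mem l.last
    rcases hv with hv | hv
    · obtain ⟨x, y, hx, hy, hxy, h⟩ := ihl nl hq.1 d1 (by simpa using hl) hv
      refine ⟨x, y, fun z => ?_, fun z => ?_, ?_, h⟩
      · rw [← hx]; simp only [steps, last, List.mem_append, List.mem_singleton, Prod.mk.injEq]
        have := @steps_snd_mem _ l.last z v r
        grind
      · rw [← hy]; simp only [steps, last, List.mem_append, List.mem_singleton, Prod.mk.injEq]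
        have := @steps_fst_mem _ l.last v z r
        grind
      · rintro rfl
        obtain ⟨rfl, rfl, -⟩ := hxy rfl
        exact absurd e1 hq.2
    · obtain ⟨x, y, hx, hy, hxy, h⟩ := ihr nr d2 hs.2 hr hv
      refine ⟨x, y, fun z => ?_, fun z => ?_, ?_, h⟩
      · rw [← hx]; simp only [steps, last, List.mem_append, List.mem_singleton, Prod.mk.injEq]
        have := @steps_snd_mem _ q z v l
        grind
      · rw [← hy]; simp only [steps, last, List.mem_append, List.mem_singleton, Prod.mk.injEq]
        have := @steps_fst_mem _ q v z l
        grind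
      · rintro rfl
        obtain ⟨rfl, rfl, -⟩ := hxy rfl
        exact absurd e3 hs.1

/-- Distinctness of the labels ensures that the arcs at a vertex of one subtree do not occur in the
other, so each vertex has one parent and exactly the children given by its constructor. -/
theorem tree_star (f : V → Lab) {c : Fin 4} {p : V} {t : LTree V} (hnd : (p :: t.verts).Nodup)
    (hf : (t.map f).Proper c) {v : V} (hv : v ∈ t.verts) :
    ∃ x, (∀ z, (z, v) ∈ t.arcs p ↔ z = x) ∧
      (v ∈ t.leaves ∧ (∀ z, (v, z) ∉ t.arcs p) ∨
        v ∉ t.leaves ∧ (∃ y, x ≠ y ∧ (∀ z, (v, z) ∈ t.arcs p ↔ z = y) ∧ (f v).un = true ∧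
          (f v).arc ≠ (f v).aux ∧ (f v).aux = (f y).arc) ∨
        v ∉ t.leaves ∧ (∃ y y', x ≠ y ∧ x ≠ y' ∧ y ≠ y' ∧
          (∀ z, (v, z) ∈ t.arcs p ↔ z = y ∨ z = y') ∧ (f v).un = false ∧
          [(f v).arc, (f y).arc, (f y').arc, (f v).aux].Nodup)) := by
  induction t generalizing c p with
  | leaf w =>
    simp only [verts, List.nodup_cons, List.mem_singleton] at hv hnd; subst hv
    refine ⟨p, fun z => by simp [arcs], .inl ⟨by simp [leaves], fun z => ?_⟩⟩
    simp [arcs]; grind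
  | un w t ih =>
    obtain ⟨hun, hne, harc, -, ht⟩ := hf
    simp only [verts, List.nodup_cons, List.mem_cons, not_or] at hv hnd
    obtain ⟨⟨hpw, hp⟩, hw, hnd⟩ := hnd
    rcases hv with rfl | hv
    · refine ⟨p, fun z => ?_, .inr (.inl ⟨fun h => hw (mem_verts_of_mem_leaves h), t.root,
        fun h => hp (h ▸ t.root_mem_verts), fun z => ?_, hun, hne, by simpa using harc⟩)⟩
      · simp only [arcs, List.mem_cons, Prod.mk.injEq]
        have := @arcs_snd_mem _ v z v t
        grind
      · simp only [arcs, List.mem_cons, Prod.mk.injEq]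
        have := @arcs_fst_mem _ v v z t
        have := t.root_arc_mem v
        grind
    · have hvw : v ≠ w := by rintro rfl; exact hw hv
      have hvp : v ≠ p := by rintro rfl; exact hp hv
      obtain ⟨x, hx, h⟩ := ih (p := w) (List.nodup_cons.2 ⟨hw, hnd⟩) ht hv
      refine ⟨x, fun z => ?_, ?_⟩
      · rw [← hx]; simp [arcs, hvw]
      · simpa [arcs, hvp, leaves] using h
  | bin w l r ihl ihr =>
    obtain ⟨hun, hcol, -, -, -, hl, hr⟩ := hf
    simp only [verts, List.nodup_cons, List.nodup_append, List.mem_cons, List.mem_append,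
      not_or] at hv hnd
    obtain ⟨⟨hpw, hpl, hpr⟩, ⟨hwl, hwr⟩, nl, nr, disj⟩ := hnd
    have el := l.root_mem_verts
    have er := r.root_mem_verts
    rcases hv with rfl | hv | hv
    · refine ⟨p, fun z => ?_, .inr (.inr ⟨?_, l.root, r.root, ?_, ?_, ?_, fun z => ?_, hun,
        by simpa using hcol⟩)⟩
      · simp only [arcs, List.mem_cons, List.mem_append, Prod.mk.injEq]
        have := @arcs_snd_mem _ v z v l
        have := @arcs_snd_mem _ v z v r
        grind
      · simp only [leaves, List.mem_append, not_or]
        exact ⟨fun h => hwl (mem_verts_of_mem_leaves h), fun h => hwr (mem_verts_of_mem_leaves h)⟩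
      · exact fun h => hpl (h ▸ el)
      · exact fun h => hpr (h ▸ er)
      · exact disj _ el _ er
      · simp only [arcs, List.mem_cons, List.mem_append, Prod.mk.injEq]
        have := @arcs_fst_mem _ v v z l
        have := @arcs_fst_mem _ v v z r
        have := l.root_arc_mem v
        have := r.root_arc_mem v
        grind
    · have hvr : v ∉ r.verts := fun h => disj _ hv _ h rfl
      have hvw : v ≠ w := by rintro rfl; exact hwl hv
      have hvp : v ≠ p := by rintro rfl; exact hpl hv
      have h1 : ∀ z, (z, v) ∉ r.arcs w := fun z h => hvr (arcs_snd_mem h)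
      have h2 : ∀ z, (v, z) ∉ r.arcs w := fun z h =>
        (arcs_fst_mem h).elim hvr fun h => hvw h.1
      have h3 : v ∉ r.leaves := fun h => hvr (mem_verts_of_mem_leaves h)
      obtain ⟨x, hx, h⟩ := ihl (p := w) (List.nodup_cons.2 ⟨hwl, nl⟩) hl hv
      refine ⟨x, fun z => ?_, ?_⟩
      · rw [← hx]; simp [arcs, hvw, h1]
      · simpa [arcs, hvp, leaves, h2, h3] using h
    · have hvl : v ∉ l.verts := fun h => disj _ h _ hv rfl
      have hvw : v ≠ w := by rintro rfl; exact hwr hv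
      have hvp : v ≠ p := by rintro rfl; exact hpr hv
      have h1 : ∀ z, (z, v) ∉ l.arcs w := fun z h => hvl (arcs_snd_mem h)
      have h2 : ∀ z, (v, z) ∉ l.arcs w := fun z h =>
        (arcs_fst_mem h).elim hvl fun h => hvw h.1
      have h3 : v ∉ l.leaves := fun h => hvl (mem_verts_of_mem_leaves h)
      obtain ⟨x, hx, h⟩ := ihr (p := w) (List.nodup_cons.2 ⟨hwr, nr⟩) hr hv
      refine ⟨x, fun z => ?_, ?_⟩
      · rw [← hx]; simp [arcs, hvw, h1]
      · simpa [arcs, hvp, leaves, h2, h3] using h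

theorem leaves_length_of_root_mem {t : LTree α} (hnd : t.verts.Nodup) (h : t.root ∈ t.leaves) :
    t.leaves.length = 1 := by
  cases t with
  | leaf v => rfl
  | un v t =>
    simp only [verts, List.nodup_cons] at hnd
    exact absurd (mem_verts_of_mem_leaves (t := t) h) hnd.1
  | bin v l r =>
    simp only [verts, List.nodup_cons, List.mem_append, not_or] at hnd
    simp only [leaves, root, List.mem_append] at h
    exact (h.elim (fun h => hnd.1.1 (mem_verts_of_mem_leaves h))
      fun h => hnd.1.2 (mem_verts_of_mem_leaves h)).elim

theorem leaves_length_of_first_eq_last {t : LTree α} (hnd : t.leaves.Nodup)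
    (h : t.first = t.last) : t.leaves.length = 1 := by
  obtain ⟨l, hl⟩ := t.leaves_eq_cons
  obtain ⟨l', hl'⟩ := t.leaves_eq_concat
  cases l' with
  | nil => simp [hl']
  | cons a l' =>
    have ha : a = t.last := by
      have := hl.symm.trans hl'
      simp only [List.cons_append, List.cons.injEq] at this
      rw [← h, this.1]
    rw [hl', ha] at hnd
    simp at hnd

theorem nodup_leaves {t : LTree α} (hnd : t.verts.Nodup) : t.leaves.Nodup := by
  induction t with
  | leaf v => simp [leaves]
  | un v t ih => exact ih (List.nodup_cons.1 hnd).2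
  | bin v l r ihl ihr =>
    simp only [verts, List.nodup_cons, List.nodup_append] at hnd
    simp only [leaves, List.nodup_append]
    exact ⟨ihl hnd.2.1, ihr hnd.2.2.1, fun a ha b hb => hnd.2.2.2 a (mem_verts_of_mem_leaves ha) b
      (mem_verts_of_mem_leaves hb)⟩

theorem compat_of_mem_arcs (f : V → Lab) {c : Fin 4} {p : V} {t : LTree V}
    (hp : (f p).Compat (f t.root)) (hp' : (f p).un = true →
      (f p).arc ≠ (f p).aux ∧ (f p).aux = (f t.root).arc) (hf : (t.map f).Proper c)
    {x y : V} (h : (x, y) ∈ t.arcs p) : (f x).palette ≠ (f y).palette := by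
  induction t generalizing c p with
  | leaf v =>
    simp only [arcs, List.mem_singleton, Prod.mk.injEq] at h
    rw [h.1, h.2]; exact hp.palette_ne hp'
  | un v t ih =>
    obtain ⟨hun, hne, harc, hc, ht⟩ := hf
    simp only [arcs, List.mem_cons, Prod.mk.injEq] at h
    rcases h with ⟨rfl, rfl⟩ | h
    · exact hp.palette_ne hp'
    · exact ih (by simpa using hc) (fun _ => ⟨hne, by simpa using harc⟩) ht h
  | bin v l r ihl ihr =>
    obtain ⟨hun, -, hcl, hcr, -, hl, hr⟩ := hf
    simp only [arcs, List.mem_cons, List.mem_append, Prod.mk.injEq] at h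
    rcases h with ⟨rfl, rfl⟩ | h | h
    · exact hp.palette_ne hp'
    · exact ihl (by simpa using hcl) (by simp [hun]) hl h
    · exact ihr (by simpa using hcr) (by simp [hun]) hr h

theorem aux_ne_of_mem_steps (f : V → Lab) {c : Fin 4} {q : V} {t : LTree V}
    (hq : (f q).aux ≠ (f t.first).aux) (hf : (t.map f).Proper c)
    {x y : V} (h : (x, y) ∈ t.steps q) : (f x).aux ≠ (f y).aux := by
  induction t generalizing c q with
  | leaf v =>
    simp only [steps, List.mem_singleton, Prod.mk.injEq] at h
    rw [h.1, h.2]; exact hq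
  | un v t ih => exact ih hq hf.2.2.2.2 h
  | bin v l r ihl ihr =>
    obtain ⟨-, -, -, -, hm, hl, hr⟩ := hf
    rcases List.mem_append.1 h with h | h
    · exact ihl hq hl h
    · exact ihr (by simpa using hm) hr h

end LTree

theorem setOf_mem_eq_compl : ∀ {a b c m : Fin 4}, [a, b, c, m].Nodup →
    ({k | k = a ∨ k = b ∨ k = c} : Set (Fin 4)) = {m}ᶜ := by
  intro a b c m h
  ext k
  simp only [Set.mem_ofPred_eq, Set.mem_compl_iff, Set.mem_singleton_iff]
  revert a b c m k; decide

namespace LTree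

/-- The graph that consists of a tree and of the cycle through its leaves inherits an AVD colouring
from a proper labelling. -/
theorem exists_isAVD {V : Type*} {G : SimpleGraph V} {p : V} {t : LTree V}
    (hnd : (p :: t.verts).Nodup) (hall : ∀ v, v ∈ p :: t.verts) (hlen : 2 ≤ t.leaves.length)
    (hadj : ∀ u v, G.Adj u v ↔ (u, v) ∈ t.arcs p ++ t.rim p ∨ (v, u) ∈ t.arcs p ++ t.rim p)
    (f : V → Lab) (hf : (t.map f).ProperAt (f p)) :
    ∃ c : G.lineGraph.Coloring (Fin 4), IsAVD c ∧
      ∃ u v, G.Adj u v ∧ (colorsAt c u).ncard = 3 ∧ (colorsAt c v).ncard = 3 := by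
  obtain ⟨hun, hcol, hcompat, hfirst, hlast, hf⟩ := hf
  simp only [root_map, first_map, last_map] at hcol hcompat hfirst hlast
  obtain ⟨hp, hnt⟩ := List.nodup_cons.1 hnd
  have hpl : p ∉ t.leaves := fun h => hp (mem_verts_of_mem_leaves h)
  have hnl := nodup_leaves hnt
  -- The colour of a tree edge is stored at the child, and that of a cycle edge at the leaf it
  -- enters.
  let K : V → V → Fin 4 → Prop := fun u v k =>
    (u, v) ∈ t.arcs p ∧ k = (f v).arc ∨ (v, u) ∈ t.arcs p ∧ k = (f u).arc ∨
    (u, v) ∈ t.rim p ∧ k = (f v).rim ∨ (v, u) ∈ t.rim p ∧ k = (f u).rim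
  have hrim_fst : ∀ {x y}, (x, y) ∈ t.rim p → x ∈ p :: t.leaves := by
    intro x y h
    rw [rim_eq] at h
    have := @steps_fst_mem _ p x y t
    have := t.last_mem
    grind
  have hrim_snd : ∀ {x y}, (x, y) ∈ t.rim p → y ∈ p :: t.leaves := by
    intro x y h
    rw [rim_eq] at h
    have := @steps_snd_mem _ p x y t
    grind
  have harc_fst : ∀ {x y}, (x, y) ∈ t.arcs p → x ∉ t.leaves := by
    intro x y h hx
    obtain ⟨_, _, h' | h' | h'⟩ := tree_star f hnd hf (mem_verts_of_mem_leaves hx)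
    · exact h'.2 _ h
    · exact h'.1 hx
    · exact h'.1 hx
  have star : ∀ v, ∃ L : List (V × Fin 4), (∀ y k, K v y k ↔ (y, k) ∈ L) ∧
      (L.map Prod.fst).Nodup ∧ (L.map Prod.snd).Nodup ∧
      {k | k ∈ L.map Prod.snd} = (f v).palette := by
    intro v
    by_cases hvp : v = p
    · subst hvp
      have hA : ∀ y, (v, y) ∈ t.arcs v ↔ y = t.root := fun y =>
        ⟨fun h => (arcs_fst_mem h).elim (fun h => absurd h hp) fun h => h.2,
          fun h => h ▸ root_arc_mem _ _⟩
      have hA' : ∀ y, (y, v) ∉ t.arcs v := fun y h => hp (arcs_snd_mem h)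
      have hR : ∀ y, (v, y) ∈ t.rim v ↔ y = t.first := by
        intro y
        rw [rim_eq]
        have := @steps_fst_mem _ v v y t
        have := t.first_step_mem v
        have := t.last_mem
        grind
      have hR' : ∀ y, (y, v) ∈ t.rim v ↔ y = t.last := by
        intro y
        rw [rim_eq]
        have := @steps_snd_mem _ v y v t
        grind
      refine ⟨[(t.last, (f v).rim), (t.root, (f t.root).arc), (t.first, (f t.first).rim)],
        fun y k => ?_, ?_, ?_, ?_⟩
      · simp only [K, hA, hA', hR, hR', List.mem_cons, List.not_mem_nil, Prod.mk.injEq]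
        grind
      · have h1 : t.last ≠ t.root := fun h => by
          have := leaves_length_of_root_mem hnt (h ▸ t.last_mem); omega
        have h2 : t.root ≠ t.first := fun h => by
          have := leaves_length_of_root_mem hnt (h ▸ t.first_mem); omega
        have h3 : t.last ≠ t.first := fun h => by
          have := leaves_length_of_first_eq_last hnl h.symm; omega
        simp [h1, h2, h3]
      · exact hcol.sublist (List.prefix_append _ [_]).sublist
      · simp only [Lab.palette, hun, Bool.false_eq_true, if_false]
        simpa using setOf_mem_eq_compl hcol
    have hv : v ∈ t.verts := (List.mem_cons.1 (hall v)).resolve_left hvp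
    obtain ⟨x, hx, ⟨hl, h⟩ | ⟨hl, y, hxy, hy, hvun, hne, haux⟩ |
      ⟨hl, y, y', h1, h2, h3, hy, hvun, hc⟩⟩ := tree_star f hnd hf hv
    · obtain ⟨a, b, ha, hb, hab, hvun, hc⟩ := rim_star f hnl hpl hpl hf hl
      rw [← rim_eq] at ha hb
      have hab' : a ≠ b := fun h => by have := (hab h).2.2; omega
      have hxl : x ∉ p :: t.leaves := by
        rw [List.mem_cons, not_or]
        refine ⟨?_, harc_fst ((hx x).2 rfl)⟩
        rintro rfl
        have := (arcs_fst_mem ((hx x).2 rfl)).resolve_left hp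
        have := leaves_length_of_root_mem hnt (this.2 ▸ hl)
        omega
      have hxa : x ≠ a := by
        rintro rfl; exact hxl (hrim_fst ((ha x).2 rfl))
      have hxb : x ≠ b := by
        rintro rfl; exact hxl (hrim_snd ((hb x).2 rfl))
      refine ⟨[(x, (f v).arc), (a, (f v).rim), (b, (f b).rim)], fun y k => ?_, ?_, ?_, ?_⟩
      · simp only [K, hx, h, ha, hb, List.mem_cons, List.not_mem_nil, Prod.mk.injEq]
        grind
      · simp [hxa, hxb, hab']
      · exact hc.sublist (List.prefix_append _ [_]).sublist
      · simp only [Lab.palette, hvun, Bool.false_eq_true, if_false]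
        simpa using setOf_mem_eq_compl hc
    all_goals
      have hr : ∀ y, (v, y) ∉ t.rim p := fun y h => by
        have := hrim_fst h; simp [hvp, hl] at this
      have hr' : ∀ y, (y, v) ∉ t.rim p := fun y h => by
        have := hrim_snd h; simp [hvp, hl] at this
    · refine ⟨[(x, (f v).arc), (y, (f y).arc)], fun y k => ?_, ?_, ?_, ?_⟩
      · simp only [K, hx, hy, hr, hr', List.mem_cons, List.not_mem_nil, Prod.mk.injEq]
        grind
      · simp [hxy]
      · simp [← haux, hne]
      · ext k; simp [Lab.palette, hvun, haux]
    · refine ⟨[(x, (f v).arc), (y, (f y).arc), (y', (f y').arc)], fun y k => ?_, ?_, ?_, ?_⟩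
      · simp only [K, hx, hy, hr, hr', List.mem_cons, List.not_mem_nil, Prod.mk.injEq]
        grind
      · simp [h1, h2, h3]
      · exact hc.sublist (List.prefix_append _ [_]).sublist
      · simp only [Lab.palette, hvun, Bool.false_eq_true, if_false]
        simpa using setOf_mem_eq_compl hc
  have hpal : ∀ v, {k | ∃ y, K v y k} = (f v).palette := by
    intro v
    obtain ⟨L, hL, -, -, h⟩ := star v
    rw [← h]; ext k
    simp [hL]
  have hunleaf : ∀ v ∈ p :: t.leaves, (f v).un = false := by
    intro v hv
    rcases List.mem_cons.1 hv with rfl | hv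
    · exact hun
    · obtain ⟨_, _, _, _, _, h, _⟩ := rim_star f hnl hpl hpl hf hv
      exact h
  have havd : ∀ u v, (u, v) ∈ t.arcs p ++ t.rim p → (f u).palette ≠ (f v).palette := by
    intro u v h
    rcases List.mem_append.1 h with h | h
    · exact compat_of_mem_arcs f hcompat (by simp [hun]) hf h
    · have haux : (f u).aux ≠ (f v).aux := by
        rw [rim_eq, List.mem_append, List.mem_singleton, Prod.mk.injEq] at h
        rcases h with h | ⟨rfl, rfl⟩
        · exact aux_ne_of_mem_steps f hfirst hf h
        · exact hlast
      refine Lab.Compat.palette_ne ⟨?_, fun _ _ => haux⟩ ?_ <;>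
        simp [hunleaf u (hrim_fst h)]
  suffices ∃ c : G.lineGraph.Coloring (Fin 4), IsAVD c ∧
      ∀ v, colorsAt c v = {k | ∃ y, K v y k} by
    obtain ⟨c, hc, hcol⟩ := this
    -- This pair provides the adjacent vertices with three colours each that the lower bound needs.
    have hpf : (p, t.first) ∈ t.rim p := by
      rw [rim_eq]; exact List.mem_append_left _ (first_step_mem p t)
    have hcard : ∀ v ∈ p :: t.leaves, (colorsAt c v).ncard = 3 := by
      intro v hv
      rw [hcol, hpal, Lab.palette, hunleaf v hv]
      simp only [Bool.false_eq_true, if_false]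
      rw [Set.ncard_compl, Set.ncard_singleton, Nat.card_eq_fintype_card, Fintype.card_fin]
    exact ⟨c, hc, p, t.first, (hadj _ _).2 (.inl (List.mem_append_right _ hpf)),
      hcard _ List.mem_cons_self, hcard _ (List.mem_cons_of_mem _ t.first_mem)⟩
  refine exists_isAVD_of_stars K (fun u v k => ?_) (fun u v => ?_) (fun v => ?_) fun u v h => ?_
  · simp only [K]; tauto
  · rw [hadj]; simp only [K, List.mem_append]
    constructor
    · rintro ((h | h) | h | h)
      · exact ⟨_, .inl ⟨h, rfl⟩⟩
      · exact ⟨_, .inr (.inr (.inl ⟨h, rfl⟩))⟩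
      · exact ⟨_, .inr (.inl ⟨h, rfl⟩)⟩
      · exact ⟨_, .inr (.inr (.inr ⟨h, rfl⟩))⟩
    · rintro ⟨k, h⟩; tauto
  · obtain ⟨L, h1, h2, h3, -⟩ := star v
    exact ⟨L, h1, h2, h3⟩
  · rw [hpal, hpal]
    exact ((hadj u v).1 h).elim (havd u v) fun h => (havd v u h).symm

end LTree

/-! ### Colours on the boundary of a subtree. -/

namespace LTree

/-- Permute the colours of a label. -/
def _root_.Lab.recolor (π : Fin 4 → Fin 4) (a : Lab) : Lab :=
  ⟨π a.arc, π a.rim, π a.aux, a.un⟩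

theorem Proper.recolor {π : Fin 4 → Fin 4} (hπ : π.Injective) {c : Fin 4} {t : LTree Lab}
    (h : t.Proper c) : (t.map (Lab.recolor π)).Proper (π c) := by
  have hc : ∀ {a b : Lab}, a.Compat b → (a.recolor π).Compat (b.recolor π) := fun h =>
    ⟨fun h1 h2 => hπ.ne (h.1 h1 h2), fun h1 h2 => hπ.ne (h.2 h1 h2)⟩
  induction t generalizing c with
  | leaf a => exact ⟨h.1, by simpa [Lab.recolor] using h.2.map hπ⟩
  | un a t ih =>
    obtain ⟨h1, h2, h3, h4, h5⟩ := h
    exact ⟨h1, hπ.ne h2, by simp [Lab.recolor, h3], by simpa using hc h4, ih h5⟩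
  | bin a l r ihl ihr =>
    obtain ⟨h1, h2, h3, h4, h5, h6, h7⟩ := h
    refine ⟨h1, by simpa [Lab.recolor] using h2.map hπ, by simpa using hc h3, by simpa using hc h4,
      by simpa [Lab.recolor] using hπ.ne h5, by simpa [Lab.recolor] using ihl h6, ihr h7⟩

theorem Proper.un_root {c : Fin 4} {t : LTree Lab} (h : t.Proper c) : t.root.un = t.isUn := by
  cases t <;> exact h.1

/-- The tree has a proper labelling with the given colours at its root, its first leaf and its last
leaf. -/
def Realizes (s : LTree Unit) (a x l m r n : Fin 4) : Prop :=
  ∃ t : LTree Lab, t.shape = s ∧ t.Proper r ∧ t.root.arc = a ∧ t.root.aux = x ∧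
    t.first.rim = l ∧ t.first.aux = m ∧ t.last.aux = n

theorem Realizes.recolor {π : Fin 4 → Fin 4} (hπ : π.Injective) {s : LTree Unit}
    {a x l m r n : Fin 4} (h : s.Realizes a x l m r n) :
    s.Realizes (π a) (π x) (π l) (π m) (π r) (π n) := by
  obtain ⟨t, rfl, ht, rfl, rfl, rfl, rfl, rfl⟩ := h
  exact ⟨t.map (Lab.recolor π), shape_map _ _, ht.recolor hπ, by simp [Lab.recolor],
    by simp [Lab.recolor], by simp [Lab.recolor], by simp [Lab.recolor], by simp [Lab.recolor]⟩

theorem Realizes.leaf {a x l r : Fin 4} (h : [a, l, r, x].Nodup) :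
    Realizes (.leaf ()) a x l x r x :=
  ⟨.leaf ⟨a, l, x, false⟩, rfl, ⟨rfl, h⟩, rfl, rfl, rfl, rfl, rfl⟩

theorem Realizes.un {s : LTree Unit} {a b x l m r n : Fin 4} (h : s.Realizes b x l m r n)
    (hab : a ≠ b) (hx : s.isUn = true → a ≠ x) : Realizes (.un () s) a b l m r n := by
  obtain ⟨t, rfl, ht, rfl, rfl, rfl, rfl, rfl⟩ := h
  -- An inner vertex has no cycle edge; its rim colour 0 is a dummy.
  refine ⟨.un ⟨a, 0, t.root.arc, true⟩ t, rfl, ⟨rfl, hab, rfl, ⟨fun _ h => ?_, nofun⟩, ht⟩,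
    rfl, rfl, rfl, rfl, rfl⟩
  rw [ht.un_root] at h
  exact hx (by simpa [shape] using h)

/-- The colour `k` belongs to the cycle edge between the last leaf on the left and the first leaf on
the right; `n` and `n'` are the missing colours at these two leaves. -/
theorem Realizes.bin {s s' : LTree Unit} {a b b' x y y' l m r n n' k : Fin 4}
    (h : s.Realizes b y l m k n) (h' : s'.Realizes b' y' k n' r l')
    (hcol : [a, b, b', x].Nodup) (hn : n ≠ n') (hy : s.isUn = false → x ≠ y)
    (hy' : s'.isUn = false → x ≠ y') : Realizes (.bin () s s') a x l m r l' := by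
  obtain ⟨t, rfl, ht, rfl, rfl, rfl, rfl, rfl⟩ := h
  obtain ⟨t', rfl, ht', rfl, rfl, rfl, rfl, rfl⟩ := h'
  refine ⟨.bin ⟨a, 0, x, false⟩ t t', rfl, ⟨rfl, hcol, ⟨nofun, fun _ h => ?_⟩,
    ⟨nofun, fun _ h => ?_⟩, hn, ht, ht'⟩, rfl, rfl, rfl, rfl, rfl⟩
  · rw [ht.un_root] at h; exact hy (by simpa [shape] using h)
  · rw [ht'.un_root] at h; exact hy' (by simpa [shape] using h)

theorem Realizes.close {s : LTree Unit} {a x l m r n d : Fin 4} (h : s.Realizes a x l m r n)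
    (hcol : [r, a, l, d].Nodup) (hm : d ≠ m) (hn : n ≠ d) (hx : s.isUn = false → d ≠ x) :
    ∃ (b : Lab) (t : LTree Lab), t.shape = s ∧ t.ProperAt b := by
  obtain ⟨t, rfl, ht, rfl, rfl, rfl, rfl, rfl⟩ := h
  -- The vertex at the top has no parent; its arc colour 0 is a dummy, while `d` is its missing
  -- colour.
  refine ⟨⟨0, r, d, false⟩, t, rfl, rfl, hcol, ⟨nofun, fun _ h => ?_⟩, hm, hn, ht⟩
  rw [ht.un_root] at h; exact hx (by simpa [shape] using h)

end LTree

/-! ### Sets of quadruples of colours as natural numbers -/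

namespace Mask

/-- The digit at the place `4 ^ j` to the base 4. -/
def digit (j k : ℕ) : Fin 4 := Fin.ofNat 4 (k / 4 ^ j)

/-- Every quadruple of colours in the set that is coded by `M` has the property `Q`. -/
def Within (M : ℕ) (Q : Fin 4 → Fin 4 → Fin 4 → Fin 4 → Prop) : Prop :=
  ∀ k, M.testBit k = true → k < 256 ∧ Q (digit 0 k) (digit 1 k) (digit 2 k) (digit 3 k)

theorem Within.or {M N : ℕ} {Q : Fin 4 → Fin 4 → Fin 4 → Fin 4 → Prop} (hM : Within M Q)
    (hN : Within N Q) : Within (M ||| N) Q := by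
  intro k hk
  rw [Nat.testBit_lor, Bool.or_eq_true] at hk
  exact hk.elim (hM k) (hN k)

/-- Only lower bounds for the realized sets are followed, so a set may be replaced by a member of
the table inside it. -/
theorem Within.mono {M N : ℕ} {Q : Fin 4 → Fin 4 → Fin 4 → Fin 4 → Prop} (hN : Within N Q)
    (h : M &&& N = M) : Within M Q := by
  intro k hk
  rw [← h, Nat.testBit_land, Bool.and_eq_true] at hk
  exact hN k hk.2

/-- Replace a colour `i` in one component of the quadruples by `p i`; this component has the weight
`w`, and `S` is the set of quadruples that have the colour 0 there. -/
def axis (w S : ℕ) (p : ℕ → ℕ) (M : ℕ) : ℕ :=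
  ((M &&& S) <<< (w * p 0)) ||| ((((M >>> w) &&& S) <<< (w * p 1)) |||
    ((((M >>> (w * 2)) &&& S) <<< (w * p 2)) ||| (((M >>> (w * 3)) &&& S) <<< (w * p 3))))

theorem exists_of_testBit_axis {w S : ℕ} {p : ℕ → ℕ} {M k : ℕ}
    (h : (axis w S p M).testBit k = true) :
    ∃ n, ∃ i < 4, S.testBit n = true ∧ M.testBit (n + w * i) = true ∧ k = n + w * p i := by
  have key : ∀ i, (((M >>> (w * i)) &&& S) <<< (w * p i)).testBit k = true →
      ∃ n, S.testBit n = true ∧ M.testBit (n + w * i) = true ∧ k = n + w * p i := by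
    intro i h
    simp only [Nat.testBit_shiftLeft, Nat.testBit_land, Nat.testBit_shiftRight, Bool.and_eq_true,
      decide_eq_true_eq] at h
    exact ⟨k - w * p i, h.2.2, by rw [add_comm]; exact h.2.1, by omega⟩
  simp only [axis, Nat.testBit_lor, Bool.or_eq_true] at h
  rcases h with h | h | h | h
  · obtain ⟨n, hn⟩ := key 0 (by simpa using h); exact ⟨n, 0, by omega, hn⟩
  · obtain ⟨n, hn⟩ := key 1 (by simpa using h); exact ⟨n, 1, by omega, hn⟩
  · obtain ⟨n, hn⟩ := key 2 h; exact ⟨n, 2, by omega, hn⟩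
  · obtain ⟨n, hn⟩ := key 3 h; exact ⟨n, 3, by omega, hn⟩

/-- The quadruples with first, ..., fourth component 0. -/
def zeros₀ : ℕ := 0x1111111111111111111111111111111111111111111111111111111111111111
def zeros₁ : ℕ := 0x000f000f000f000f000f000f000f000f000f000f000f000f000f000f000f000f
def zeros₂ : ℕ := 0x000000000000ffff000000000000ffff000000000000ffff000000000000ffff
def zeros₃ : ℕ := 0x000000000000000000000000000000000000000000000000ffffffffffffffff

/-- Higher bits vanish, which reduces statements about all members of a coded set to a check of 256
positions. -/
theorem of_testBit {S : ℕ} (hS : S < 2 ^ 256) {p : ℕ → Prop}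
    (h : ∀ n < 256, S.testBit n = true → p n) {n : ℕ} (hn : S.testBit n = true) :
    n < 256 ∧ p n := by
  have : n < 256 := by
    by_contra hn'
    rw [Nat.testBit_lt_two_pow (hS.trans_le (Nat.pow_le_pow_right (by norm_num) (by omega)))] at hn
    simp at hn
  exact ⟨this, h n this hn⟩

/-- Apply the permutation `p` of the colours to a set of quadruples. -/
def permute (p : ℕ → ℕ) (M : ℕ) : ℕ :=
  axis 1 zeros₀ p (axis 4 zeros₁ p (axis 16 zeros₂ p (axis 64 zeros₃ p M)))

/-- The components are recoloured one at a time, the last one first. The intermediate predicates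
remember a preimage for each component already treated. -/
theorem Within.permute {M : ℕ} {Q Q' : Fin 4 → Fin 4 → Fin 4 → Fin 4 → Prop} (h : Within M Q)
    (π : Fin 4 → Fin 4) {p : ℕ → ℕ} (hp : ∀ i : Fin 4, p i = π i)
    (hQ : ∀ l m r n, Q l m r n → Q' (π l) (π m) (π r) (π n)) : Within (permute p M) Q' := by
  have hp' : ∀ i (hi : i < 4), p i = π ⟨i, hi⟩ := fun i hi => hp ⟨i, hi⟩
  have h3 : Within (axis 64 zeros₃ p M)
      fun l m r n => ∃ n', n = π n' ∧ Q l m r n' := by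
    intro k hk
    obtain ⟨n, i, hi, hS, hM, rfl⟩ := exists_of_testBit_axis hk
    obtain ⟨-, hq⟩ := h _ hM
    obtain ⟨hn, h0⟩ := of_testBit (p := fun n => n / 4 ^ 3 % 4 = 0) (by decide +kernel)
      (by decide +kernel) hS
    rw [hp' i hi]
    refine ⟨by omega, ⟨i, hi⟩, ?_, ?_⟩
    · ext; simp [digit]; omega
    · convert hq using 1 <;> (ext; simp [digit]; omega)
  have h2 : Within (axis 16 zeros₂ p (axis 64 zeros₃ p M))
      fun l m r n => ∃ r', r = π r' ∧ ∃ n', n = π n' ∧ Q l m r' n' := by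
    intro k hk
    obtain ⟨n, i, hi, hS, hM, rfl⟩ := exists_of_testBit_axis hk
    obtain ⟨-, n', hn', hq⟩ := h3 _ hM
    obtain ⟨hn, h0⟩ := of_testBit (p := fun n => n / 4 ^ 2 % 4 = 0) (by decide +kernel)
      (by decide +kernel) hS
    rw [hp' i hi]
    refine ⟨by omega, ⟨i, hi⟩, ?_, ?_⟩
    · ext; simp [digit]; omega
    · refine ⟨n', ?_, ?_⟩
      · rw [← hn']; ext; simp [digit]; omega
      · convert hq using 1 <;> (ext; simp [digit]; omega)
  have h1 : Within (axis 4 zeros₁ p (axis 16 zeros₂ p (axis 64 zeros₃ p M)))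
      fun l m r n => ∃ m', m = π m' ∧ ∃ r', r = π r' ∧ ∃ n', n = π n' ∧ Q l m' r' n' := by
    intro k hk
    obtain ⟨n, i, hi, hS, hM, rfl⟩ := exists_of_testBit_axis hk
    obtain ⟨-, r', hr', n', hn', hq⟩ := h2 _ hM
    obtain ⟨hn, h0⟩ := of_testBit (p := fun n => n / 4 ^ 1 % 4 = 0) (by decide +kernel)
      (by decide +kernel) hS
    rw [hp' i hi]
    refine ⟨by omega, ⟨i, hi⟩, ?_, ?_⟩
    · ext; simp [digit]; omega
    · refine ⟨r', ?_, n', ?_, ?_⟩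
      · rw [← hr']; ext; simp [digit]; omega
      · rw [← hn']; ext; simp [digit]; omega
      · convert hq using 1 <;> (ext; simp [digit]; try omega)
  intro k hk
  obtain ⟨n, i, hi, hS, hM, rfl⟩ := exists_of_testBit_axis hk
  obtain ⟨-, m', hm, r', hr, n', hn', hq⟩ := h1 _ hM
  obtain ⟨hn, h0⟩ := of_testBit (p := fun n => n / 4 ^ 0 % 4 = 0) (by decide +kernel)
      (by decide +kernel) hS
  rw [hp' i hi]
  refine ⟨by omega, ?_⟩
  have e0 : digit 0 (n + 1 * i) = ⟨i, hi⟩ := by ext; simp [digit]; omega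
  have e0' : digit 0 (n + 1 * (π ⟨i, hi⟩ : Fin 4)) = π ⟨i, hi⟩ := by ext; simp [digit]; omega
  have e1 : digit 1 (n + 1 * (π ⟨i, hi⟩ : Fin 4)) = digit 1 (n + 1 * i) := by
    ext; simp [digit]; omega
  have e2 : digit 2 (n + 1 * (π ⟨i, hi⟩ : Fin 4)) = digit 2 (n + 1 * i) := by
    ext; simp [digit]; omega
  have e3 : digit 3 (n + 1 * (π ⟨i, hi⟩ : Fin 4)) = digit 3 (n + 1 * i) := by
    ext; simp [digit]; omega
  rw [e0', e1, e2, e3, hm, hr, hn']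
  rw [e0] at hq
  exact hQ _ _ _ _ hq

/-- The first two components of the quadruples in `M` whose other two components are coded by `i`. -/
def row (i M : ℕ) : ℕ := (M >>> (16 * i)) &&& 0xffff

/-- The last two components, in their places, of the quadruples in `M` whose other two components
are coded by `i`. -/
def column (i M : ℕ) : ℕ :=
  (M >>> i) &&& 0x0001000100010001000100010001000100010001000100010001000100010001

theorem testBit_row {i M k : ℕ} (h : (row i M).testBit k = true) :
    k < 16 ∧ M.testBit (16 * i + k) = true := by
  simp only [row, Nat.testBit_land, Nat.testBit_shiftRight, Bool.and_eq_true] at h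
  refine ⟨?_, h.1⟩
  by_contra hk
  rw [Nat.testBit_lt_two_pow (show 0xffff < 2 ^ k from
    lt_of_lt_of_le (by norm_num : 0xffff < 2 ^ 16) (Nat.pow_le_pow_right (by norm_num) (by omega)))]
    at h
  simp at h

theorem row_lt (i M : ℕ) : row i M < 2 ^ 16 :=
  (Nat.and_le_right).trans_lt (by norm_num)

theorem testBit_column {i M k : ℕ} (h : (column i M).testBit k = true) :
    k % 16 = 0 ∧ M.testBit (i + k) = true := by
  simp only [column, Nat.testBit_land, Nat.testBit_shiftRight, Bool.and_eq_true] at h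
  exact ⟨(of_testBit (p := fun n => n % 16 = 0) (by decide +kernel) (by decide +kernel) h.2).2, h.1⟩

/-- The binary digits of `y` are at least 16 places apart and `x` has at most 16 digits, so the
product consists of disjoint shifted copies of `x`, without carries. Multiplication thus computes a
Cartesian product of sets of pairs. -/
theorem testBit_mul_of_spread {x : ℕ} (hx : x < 2 ^ 16) (y : ℕ)
    (hy : ∀ k, y.testBit k = true → k % 16 = 0) (k : ℕ) (h : (x * y).testBit k = true) :
    x.testBit (k % 16) = true ∧ y.testBit (k / 16 * 16) = true := by
  induction y using Nat.strong_induction_on generalizing k with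
  | _ y ih =>
    rcases Nat.eq_zero_or_pos y with rfl | hpos
    · simp at h
    have hdiv : y = 2 ^ 16 * (y / 2 ^ 16) + y % 2 ^ 16 := (Nat.div_add_mod _ _).symm
    -- Of the lowest 16 digits of `y` only the one at place 0 can be nonzero.
    have hmod : y % 2 ^ 16 = 0 ∨ y % 2 ^ 16 = 1 := by
      suffices y % 2 ^ 16 = y % 2 ^ 1 by omega
      apply Nat.eq_of_testBit_eq
      intro i
      simp only [Nat.testBit_mod_two_pow]
      cases hb : y.testBit i
      · simp
      · have := hy i hb
        simp only [Bool.and_true, decide_eq_decide]; omega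
    have hprod : x * y = 2 ^ 16 * (x * (y / 2 ^ 16)) + x * (y % 2 ^ 16) := by
      conv_lhs => rw [hdiv]
      ring
    have hlt : x * (y % 2 ^ 16) < 2 ^ 16 := by rcases hmod with h | h <;> rw [h] <;> omega
    rw [hprod, Nat.testBit_two_pow_mul_add _ hlt] at h
    split_ifs at h with hk
    · have h1 : y % 2 ^ 16 = 1 := by
        rcases hmod with h0 | h0
        · rw [h0] at h; simp at h
        · exact h0
      rw [h1, mul_one] at h
      refine ⟨by rwa [Nat.mod_eq_of_lt hk], ?_⟩
      rw [Nat.div_eq_of_lt hk, zero_mul, Nat.testBit_zero]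
      simp; omega
    · have := ih (y / 2 ^ 16) (by omega) (fun j hj => ?_) (k - 16) h
      · refine ⟨by rw [show k % 16 = (k - 16) % 16 by omega]; exact this.1, ?_⟩
        have h2 := this.2
        rw [Nat.testBit_div_two_pow] at h2
        rwa [show (k - 16) / 16 * 16 + 16 = k / 16 * 16 by omega] at h2
      · rw [Nat.testBit_div_two_pow] at hj
        have := hy _ hj; omega

end Mask

/-! ### Combining the sets of two children, and passing to a parent. -/

namespace Mask

/-- The pairs `(r, m)` of distinct colours, coded by `r + 4 * m`, each with the codes of the pairs
`(r, m')` such that `m'` is different from `m`. -/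
def combos : List (ℕ × ℕ × ℕ) :=
  [(4, 8, 12), (8, 4, 12), (12, 4, 8), (1, 9, 13), (9, 1, 13), (13, 1, 9),
    (2, 6, 14), (6, 2, 14), (14, 2, 6), (3, 7, 11), (7, 3, 11), (11, 3, 7)]

def rows (L : ℕ) : List ℕ := combos.map fun c => row c.1 L
def columns (R : ℕ) : List ℕ := combos.map fun c => column c.2.1 R ||| column c.2.2 R

/-- A scalar product where the sum is replaced by the union. -/
def dot (x : List ℕ) : List ℕ → ℕ :=
  List.rec (fun _ => 0)
    (fun a _ ih y => List.rec 0 (fun b y' _ => Nat.lor (Nat.mul a b) (ih y')) y) x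

/-- Two sets are joined along the common cycle edge: a row fixes its colour and the missing colour
at the last leaf on the left, and the two columns have the same edge colour and a different missing
colour on the right. -/
theorem Within.dot {L R : ℕ} {QL QR : Fin 4 → Fin 4 → Fin 4 → Fin 4 → Prop} (hL : Within L QL)
    (hR : Within R QR) : Within (dot (rows L) (columns R))
      fun l m r n => ∃ k u v, u ≠ v ∧ QL l m k u ∧ QR k v r n := by
  have key : ∀ i j k, i < 16 → j < 16 → i % 4 = j % 4 → i / 4 ≠ j / 4 →
      (row i L).testBit (k % 16) = true → (column j R).testBit (k / 16 * 16) = true →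
      k < 256 ∧ ∃ e u v, u ≠ v ∧ QL (digit 0 k) (digit 1 k) e u ∧
        QR e v (digit 2 k) (digit 3 k) := by
    intro i j k hi hj hij hij' h1 h2
    obtain ⟨-, hQL⟩ := hL _ (testBit_row h1).2
    obtain ⟨hlt, hQR⟩ := hR _ (testBit_column h2).2
    refine ⟨by omega, Fin.ofNat 4 i, Fin.ofNat 4 (i / 4), Fin.ofNat 4 (j / 4), ?_, ?_, ?_⟩
    · intro h; have := congrArg Fin.val h; simp at this; omega
    · convert hQL using 1 <;> (ext; simp [digit]; try omega)
    · convert hQR using 1 <;> (ext; simp [digit]; try omega)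
  have step : ∀ c ∈ combos, Within (row c.1 L * (column c.2.1 R ||| column c.2.2 R))
      fun l m r n => ∃ k u v, u ≠ v ∧ QL l m k u ∧ QR k v r n := by
    intro c hc
    have hc' : ∀ c ∈ combos, c.1 < 16 ∧ c.2.1 < 16 ∧ c.2.2 < 16 ∧ c.1 % 4 = c.2.1 % 4 ∧
      c.1 % 4 = c.2.2 % 4 ∧ c.1 / 4 ≠ c.2.1 / 4 ∧ c.1 / 4 ≠ c.2.2 / 4 := by decide
    obtain ⟨h1, h2, h3, h4, h5, h6, h7⟩ := hc' c hc
    intro k hk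
    obtain ⟨hx, hy⟩ := testBit_mul_of_spread (row_lt c.1 L) _ (fun k hk => by
      rw [Nat.testBit_lor, Bool.or_eq_true] at hk
      exact hk.elim (fun h => (testBit_column h).1) fun h => (testBit_column h).1) k hk
    rw [Nat.testBit_lor, Bool.or_eq_true] at hy
    exact hy.elim (key _ _ k h1 h2 h4 h6 hx) (key _ _ k h1 h3 h5 h7 hx)
  have : ∀ cs : List (ℕ × ℕ × ℕ), (∀ c ∈ cs, c ∈ combos) →
      Within (Mask.dot (cs.map fun c => row c.1 L)
        (cs.map fun c => column c.2.1 R ||| column c.2.2 R))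
      fun l m r n => ∃ k u v, u ≠ v ∧ QL l m k u ∧ QR k v r n := by
    intro cs hcs
    induction cs with
    | nil => intro k hk; exact absurd hk (by simp [Mask.dot])
    | cons c cs ih =>
      exact (step c (hcs c (by simp))).or (ih fun c hc => hcs c (by simp [hc]))
  exact this combos fun c hc => hc

/-- The set of quadruples that arises when the colours 0, 1, 2, 3 are replaced by those listed. -/
def recolor (c : List ℕ) (M : ℕ) : ℕ := permute (fun i => c.getD i 0) M

theorem Within.recolor {M : ℕ} {s : LTree Unit} (h : Within M (s.Realizes 0 1)) (a x b c : Fin 4)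
    (hn : [a, x, b, c].Nodup) :
    Within (recolor [a, x, b, c] M) (s.Realizes a x) := by
  have hinj : Function.Injective ![a, x, b, c] := by
    revert a x b c; decide
  exact h.permute ![a, x, b, c] (fun i => by fin_cases i <;> rfl)
    fun l m r n hl => hl.recolor hinj

/-- The colours around a child with the colour `a` of the edge to the parent and with given first
and last leaves, when the other child has the colour `b` and the parent the colours 0 and 1. -/
def asChild (a b : ℕ) (un : Bool) (M : ℕ) : ℕ :=
  recolor [a, 0, 1, b] M ||| (recolor [a, b, 0, 1] M ||| bif un then recolor [a, 1, 0, b] M else 0)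

/-- The colours around a vertex with exactly one child. -/
def step (un : Bool) (M : ℕ) : ℕ :=
  recolor [1, 2, 0, 3] M ||| (recolor [1, 3, 0, 2] M ||| bif un then 0 else recolor [1, 0, 2, 3] M)

theorem within_zero (Q : Fin 4 → Fin 4 → Fin 4 → Fin 4 → Prop) : Within 0 Q := by
  intro k hk; simp at hk

theorem Within.imp {M : ℕ} {Q Q' : Fin 4 → Fin 4 → Fin 4 → Fin 4 → Prop} (h : Within M Q)
    (hQ : ∀ l m r n, Q l m r n → Q' l m r n) : Within M Q' :=
  fun k hk => ⟨(h k hk).1, hQ _ _ _ _ (h k hk).2⟩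

/-- Besides `a`, the auxiliary colour at the child can be 0, `b` or 1. The value 1 is the colour
missing at the parent and is admitted only when the child has degree two. -/
theorem Within.asChild {M : ℕ} {s : LTree Unit} (h : Within M (s.Realizes 0 1)) (a b : Fin 4)
    (hn : [a, 0, 1, b].Nodup) : Within (asChild a b s.isUn M)
      fun l m r n => ∃ y, (s.isUn = false → 1 ≠ y) ∧ s.Realizes a y l m r n := by
  have hb : 1 ≠ b := by clear h; revert a b; decide
  refine .or ((h.recolor a 0 1 b hn).imp fun l m r n h => ⟨0, fun _ => by decide, h⟩)
    (.or ((h.recolor a b 0 1 ?_).imp fun l m r n h => ⟨b, fun _ => hb, h⟩) ?_)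
  · clear h; revert a b; decide
  · cases hs : s.isUn
    · exact within_zero _
    · exact (h.recolor a 1 0 b (by clear h hs; revert a b; decide)).imp fun l m r n h => ⟨1, by simp, h⟩

theorem Within.bin {M N : ℕ} {s s' : LTree Unit} (h : Within M (s.Realizes 0 1))
    (h' : Within N (s'.Realizes 0 1)) :
    Within (Mask.dot (rows (Mask.asChild 2 3 s.isUn M)) (columns (Mask.asChild 3 2 s'.isUn N)) |||
      Mask.dot (rows (Mask.asChild 3 2 s.isUn M)) (columns (Mask.asChild 2 3 s'.isUn N)))
      ((LTree.bin () s s').Realizes 0 1) := by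
  have key : ∀ a b : Fin 4, [0, a, b, 1].Nodup → ∀ l m r n, (∃ k u v, u ≠ v ∧
      (∃ y, (s.isUn = false → 1 ≠ y) ∧ s.Realizes a y l m k u) ∧
      ∃ y, (s'.isUn = false → 1 ≠ y) ∧ s'.Realizes b y k v r n) →
      (LTree.bin () s s').Realizes 0 1 l m r n := by
    rintro a b hab l m r n ⟨k, u, v, huv, ⟨y, hy, h1⟩, y', hy', h2⟩
    exact h1.bin h2 hab huv hy hy'
  exact .or (((h.asChild 2 3 (by decide)).dot (h'.asChild 3 2 (by decide))).imp
    (key 2 3 (by decide))) (((h.asChild 3 2 (by decide)).dot (h'.asChild 2 3 (by decide))).imp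
    (key 3 2 (by decide)))

/-- The edge to the child has colour 1. Auxiliary colour 0 at the child is harmless unless the child
also has degree two, when both palettes would be {0, 1}. -/
theorem Within.un {M : ℕ} {s : LTree Unit} (h : Within M (s.Realizes 0 1)) :
    Within (step s.isUn M) ((LTree.un () s).Realizes 0 1) := by
  have key : ∀ x : Fin 4, (s.isUn = true → 0 ≠ x) → ∀ l m r n, s.Realizes 1 x l m r n →
      (LTree.un () s).Realizes 0 1 l m r n := fun x hx l m r n h => h.un (by decide) hx
  refine .or ((h.recolor 1 2 0 3 (by decide)).imp (key 2 fun _ => by decide))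
    (.or ((h.recolor 1 3 0 2 (by decide)).imp (key 3 fun _ => by decide)) ?_)
  cases hs : s.isUn
  · exact (h.recolor 1 0 2 3 (by decide)).imp (key 0 (by simp [hs]))
  · exact within_zero _

/-- The quadruples that a single leaf realizes. -/
theorem within_leaf : Within ((1 <<< (2 + 4 * 1 + 16 * 3 + 64 * 1)) |||
    (1 <<< (3 + 4 * 1 + 16 * 2 + 64 * 1))) ((LTree.leaf ()).Realizes 0 1) := by
  have key : ∀ i k, (1 <<< i).testBit k = true → k = i := by
    intro i k h
    rw [Nat.one_shiftLeft, Nat.testBit_two_pow, decide_eq_true_eq] at h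
    exact h.symm
  refine .or (fun k hk => ?_) (fun k hk => ?_) <;> rw [key _ k hk]
  · exact ⟨by norm_num, .leaf (l := 2) (r := 3) (by decide)⟩
  · exact ⟨by norm_num, .leaf (l := 3) (r := 2) (by decide)⟩

end Mask

/-! ### Comparing and rerooting trees. -/

namespace LTree

/-- Equality of unlabelled trees. -/
def beq : LTree Unit → LTree Unit → Bool
  | leaf _, leaf _ => true
  | un _ s, un _ t => beq s t
  | bin _ s s', bin _ t t' => beq s t && beq s' t'
  | _, _ => false

theorem eq_of_beq {s t : LTree Unit} (h : beq s t = true) : s = t := by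
  induction s generalizing t with
  | leaf v => cases t <;> simp_all [beq]
  | un v s ih => cases t <;> simp_all [beq]; exact ih h
  | bin v s s' ih ih' => cases t <;> simp_all [beq]; exact ⟨ih h.1, ih' h.2⟩

/-- The rooted tree that arises when the next leaf on the cycle becomes the root. -/
def rotate {α : Type*} (x : α × LTree α) : α × LTree α :=
  go x.2 (leaf x.1)
where
  go : LTree α → LTree α → α × LTree α
    | leaf v, u => (v, u)
    | un v t, u => go t (un v u)
    | bin v l r, u => go l (bin v r u)

end LTree

/-! ### The finite certificate: a family of sets closed under the tree operations. -/

namespace Mask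

/-- A family of sets of quadruples: every tree whose root has two children and that is not one of
the small trees below realizes all quadruples of some set in the family. -/
def branching : List ℕ :=
  [
    0xb0009081b00700000005004710000500090000000d02004020800000000,
    0x60040050000000000a080090000000000000000060500a906a000000,
    0x200a200a00000206000002060000010410080000110c0200200000000000,
    0x2200220020002200000022000200220c220c0000000c0000000000000000,
    0xc80088009000c400000044005078084b040000110060800a4000000000,
    0x4a4018083190688000004104135018084104000011002080024000000000,
    0x7ac00000000000006bc00000000000000000000000d000d000000000,
    0x10002002130e010000000202310e02022002000022000104100800000000,
    0x12901b907b002150000071507b00510419080000590c2150129000000000,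
    0x500070000000000009000b00000000000000000070000b0059dc0000,
    0x30c0002000a300c00000002000620020202000000021000010000000000,
    0xac000000000000060c00000000000000000000000d000d07bd00000,
    0x505c02d078cc099c000020d04bcc480048000000000c0100100000000000,
    0x300a1008300a030600000104030600020002000000020002000200000000,
    0x21505104000000001290190800000000000000001104110833c00000,
    0x900199859dc50000000515459dc70000b0000007b005000090000000000,
    0x202020200022002000020020002220e220e0000000e0000000000000000,
    0x71d01b0051041bd00000710019083b08730400007b005b90795000000000,
    0x13901b0873d43150000071043bd860040a0800006a0c0050009000000000,
    0x20082004200c020400000208020c000000000000000002042008220c0000,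
    0x70060000000000000b0a000000000000000000005306390a00000000,
    0x1b9800903b98715400000050735431001300000033003100130000000000,
    0x8800808000000004040400400000000000000005800490033d00000,
    0x51000244400419000000208808087bd47bd800006ac0590c590c00000000,
    0x115400904b40119800000050788002d020d0000000004bcc78cc00000000,
    0x510453040100190800003908100002d020d0000000c04b047808000c0000,
    0x9cc49040bd050cc0000580870d020800240000022c03088034400000000,
    0x2b0001980b08720000001054700459985954000011004a08680400000000,
    0x199e2a0a00000000515e620600000000000000002a0a62067bde0000,
    0x3b9a484459dc73560000488859dc23443288000059cc2344328800000000,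
    0x404650547350088a000009983b9000d000d0000000d0088e404e00000000,
    0x306110e2202300a0000110e22022002020200002202320a2306330e0000,
    0x315021040000000013901208000000000000000071041b0833000000,
    0x51d051040000000019d019080000000000000000580c490c7bdc0000,
    0x99e000000000000505e00000000000000000000588849447bdc0000,
    0x246000000000000208a0000000000000000000002d220d26ac20000,
    0x8300a230e000400000306320e02002000000022000104100800000000,
    0x20206000000020000200a0000020e200e0000000c02002000220e0000,
    0x300e0002330a030e0000000233062202220200002202010e100e00000000,
    0x20e0002020a200e000000022006200a020600002202220a220622000000,
    0x63500000000000003a9000000000000000000000090c500c590e0000,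
    0x2a8e000000000000624e00000000000000000000485c489c7bde0000,
    0x356000000000000309a000000000000000000000b0e700e00000000,
    0x7a107a0c71046b1000006b0c1b08000400080000480c2350329000000000,
    0x40204020400080000200820080200200000002200020c200c220c0000,
    0x730c03446b043b0c000030887a080bde70de000048c00b06700a00000000,
    0x19d82bde0000000051d472de00000000000000002b9e725e6ade0000,
    0x20e22020002200e0000220200022006020a0000000e220e220e22020000,
    0x200622000206020a00002200200a0200200000002200000e000e00020000,
    0x306110e2304300a0000110e3208330a33060000330e310e130e110e0000,
    0x6054005060540a98000000900a9860040a0800006a0c60d40ad86adc0000,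
    0xbde00000000000070de000000000000000000007a0a6b0600000000,
    0x20c020c0208200c0000200c2004220022000000220022082204220c0000,
    0x509a509a000009560000095600000b0e700e00007b0e0956509a00000000]

/-- The same for the trees whose root has exactly one child. -/
def unary : List ℕ :=
  [
    0x10002000000000000100020000100010000000c000020002000c0000,
    0x100000004000010000000000080000000000000000000004000800000000,
    0x88000000088404000000000004450500990000000cc1010011000000000,
    0x23005880280e320000004940420e20000200000000021100110011100000,
    0x7a0a6b060000330e0000000000000000,
    0xc000d0009000c0000000d0005000000000000000000090005000d00000,
    0xb000a00090070000000600050007a006b000000330079005b0033000000,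
    0x3cc080a089030cc000040064050580849040000110068804a4022000000,
    0xbcc0ada099e70cc000060d6505e00000000000000000000000000000000,
    0x402520100000800002092100002022002000022000800400022c00000, 0xbde70de00007bd00000000000000000,
    0x5000500050009000000090009000d000d0000000d000c000c000c00000,
    0x7300730073003b0000003b003b0059005900000059006a006a006a000000,
    0x7056730e73d00b9a00003b0e3bd000000000000000000000000000000000]

local notation "o" => LTree.leaf ()
local infixl:70 " ⋆ " => LTree.bin ()

/-- The subtrees of the exceptional trees, with the quadruples that they realize. -/
def small : List (LTree Unit × ℕ) :=
  [
    (o,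
      0x400080000000000000000000000000),
    (o ⋆ o,
      0x2000104000000002000100800000000000000000100100000000000),
    (o ⋆ (o ⋆ o),
      0x600020202000a0000000220020002000200002200000a000600000000),
    ((o ⋆ o) ⋆ o,
      0x110000000000000101000000000000000000000080840047bcc0000),
    (o ⋆ (o ⋆ (o ⋆ o)),
      0x200000c000020000000000c0000200002000000000020000200000c0000),
    (((o ⋆ o) ⋆ o) ⋆ o,
      0x8880000000000004044000000000000000000002202220200000000),
    (o ⋆ (o ⋆ (o ⋆ (o ⋆ o))),
      0x20082200000c020400002200000c020420080000000c0204200822000000),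
    (o ⋆ (((o ⋆ o) ⋆ o) ⋆ o),
      0x2000200000000200000002000000010410080000110c0200200000000000),
    ((o ⋆ o) ⋆ ((o ⋆ o) ⋆ o),
      0x5bdc40045bdc79dc0000080879dc00c400c8000000cc00c400c800000000),
    ((o ⋆ (o ⋆ o)) ⋆ (o ⋆ o),
      0x7900090059005b0000005000590059dc59dc000059005b54799800000000),
    ((o ⋆ (o ⋆ (o ⋆ o))) ⋆ o,
      0x60040050000000000a08009000000000000000000050009000000000),
    ((((o ⋆ o) ⋆ o) ⋆ o) ⋆ o,
      0x62460000000000002a8a000000000000000000005154199800000000),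
    (o ⋆ (o ⋆ (o ⋆ (o ⋆ (o ⋆ o)))),
      0x200c2200220c020c00002200220c020c200c0000220c020c200c22000000),
    (o ⋆ ((((o ⋆ o) ⋆ o) ⋆ o) ⋆ o),
      0x100a2002130e010600000202310e02002000000022000104100800000000),
    ((o ⋆ o) ⋆ (o ⋆ (o ⋆ (o ⋆ o))),
      0x505422d07bcc0998000022d07bcc0998505400007bcc0998505422d00000),
    ((o ⋆ o) ⋆ (((o ⋆ o) ⋆ o) ⋆ o),
      0x10505b547bcc0190000079987bcc080840040000480c0190105000000000),
    ((o ⋆ (o ⋆ o)) ⋆ ((o ⋆ o) ⋆ o),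
      0x1b980b005b98715400007000795450000900000059005000090000000000),
    ((o ⋆ (o ⋆ (o ⋆ o))) ⋆ (o ⋆ o),
      0x3350130073043390000031003b081b08710400006a0c1390315000000000),
    ((o ⋆ (o ⋆ (o ⋆ (o ⋆ o)))) ⋆ o,
      0x2150510400000000129019080000000000000000510419087b000000),
    ((((o ⋆ o) ⋆ o) ⋆ o) ⋆ (o ⋆ o),
      0x51543312515419980000331219983b9a735600006ace1998515400000000),
    (((((o ⋆ o) ⋆ o) ⋆ o) ⋆ o) ⋆ o,
      0x73560000000000003b9a0000000000000000000059dc59dc00000000),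
    (o ⋆ ((o ⋆ o) ⋆ (o ⋆ (o ⋆ (o ⋆ o)))),
      0x330e110e3302330e0000110e3302330e330e00003302330e330e110e0000),
    (((((o ⋆ o) ⋆ o) ⋆ o) ⋆ (o ⋆ o)) ⋆ o,
      0x59dc7bde0000000059dc7bde00000000000000006ace6ace7bde0000),
    (o ⋆ (o ⋆ ((o ⋆ o) ⋆ (o ⋆ (o ⋆ (o ⋆ o))))),
      0x220a220e000e22060000220e000e2206220a0000000e2206220a220e0000),
    ((o ⋆ (o ⋆ (o ⋆ o))) ⋆ (((o ⋆ o) ⋆ o) ⋆ o),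
      0xa080a080000600400006004000000500090000000d060040a0800000000),
    ((((((o ⋆ o) ⋆ o) ⋆ o) ⋆ (o ⋆ o)) ⋆ o) ⋆ o,
      0x6ace0000000000006ace0000000000000000000073563b9a7bde0000),
    (o ⋆ (o ⋆ (o ⋆ ((o ⋆ o) ⋆ (o ⋆ (o ⋆ (o ⋆ o)))))),
      0x200c2200220c020c00002200220c020c200c0000220c020c200c22000000),
    (o ⋆ ((o ⋆ (o ⋆ (o ⋆ o))) ⋆ (((o ⋆ o) ⋆ o) ⋆ o)),
      0x330e2202130e330e00002202310e030430080000330c1300310022000000),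
    (o ⋆ ((((((o ⋆ o) ⋆ o) ⋆ o) ⋆ (o ⋆ o)) ⋆ o) ⋆ o),
      0x300a2002330e030600000202330e030430080000330c0304300800000000),
    ((o ⋆ o) ⋆ (((((o ⋆ o) ⋆ o) ⋆ o) ⋆ (o ⋆ o)) ⋆ o),
      0x7bdc5b547bdc7bdc000079987bdc5bdc79dc00007bcc5bdc79dc00000000),
    ((o ⋆ (o ⋆ o)) ⋆ ((((o ⋆ o) ⋆ o) ⋆ o) ⋆ (o ⋆ o)),
      0x79dc7b5459545bdc00007b98599859dc59dc000059005bdc79dc7b000000),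
    ((o ⋆ (o ⋆ ((o ⋆ o) ⋆ (o ⋆ (o ⋆ (o ⋆ o)))))) ⋆ o,
      0x71545154000000001b9819980000000000000000515419987b000000),
    ((o ⋆ ((o ⋆ o) ⋆ (o ⋆ (o ⋆ (o ⋆ o))))) ⋆ (o ⋆ o),
      0x7bdc5b547bdc7bdc000079987bdc5bdc79dc00007bcc5bdc79dc00000000),
    (((o ⋆ o) ⋆ (o ⋆ (o ⋆ (o ⋆ o)))) ⋆ ((o ⋆ o) ⋆ o),
      0x7bde62067bde7bde00002a0a7bde4bcc78cc00007bcc4bcc78cc00000000),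
    (((o ⋆ (o ⋆ (o ⋆ o))) ⋆ (((o ⋆ o) ⋆ o) ⋆ o)) ⋆ o,
      0x6b56595c000000007a9a599c0000000000000000595059907b000000),
    (((((((o ⋆ o) ⋆ o) ⋆ o) ⋆ (o ⋆ o)) ⋆ o) ⋆ o) ⋆ o,
      0x73560000000000003b9a0000000000000000000059dc59dc00000000)]

/-- A set of quadruples, for trees whose root has one or two children, possibly for a single tree
only. -/
structure Entry where
  shape : Option (LTree Unit)
  un : Bool
  mask : ℕ

/-- No completeness is claimed for these sets: they serve as an induction hypothesis whose inductive
step is a finite computation. -/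
def table : List Entry :=
  branching.map (Entry.mk none false) ++ (unary.map (Entry.mk none true) ++
    small.map fun e => Entry.mk (some e.1) false e.2)

/-- The tree realizes the quadruples of the entry. -/
def Entry.Fits (e : Entry) (s : LTree Unit) : Prop :=
  e.un = s.isUn ∧ Within e.mask (s.Realizes 0 1) ∧ ∀ s', e.shape = some s' → s' = s

/-- Apply a function to a natural number after its evaluation. -/
def force (n : ℕ) (f : ℕ → Bool) : Bool :=
  Nat.rec (f 0) (fun m _ => f (Nat.succ m)) n

theorem force_eq (n : ℕ) (f : ℕ → Bool) : force n f = f n := by cases n <;> rfl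

def forceList (x : List ℕ) : (List ℕ → Bool) → Bool :=
  List.rec (fun f => f []) (fun a _ ih f => force a fun a' => ih fun x' => f (a' :: x')) x

theorem forceList_eq (x : List ℕ) (f : List ℕ → Bool) : forceList x f = f x := by
  induction x generalizing f with
  | nil => rfl
  | cons a x ih =>
    refine (force_eq a fun a' => forceList x fun x' => f (a' :: x')).trans ?_
    exact ih fun x' => f (a :: x')

/-- The rows and columns for the two colours that a child can have. -/
structure Prepared where
  entry : Entry
  rows₂ : List ℕ
  rows₃ : List ℕ
  columns₂ : List ℕ
  columns₃ : List ℕ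

def prepared (e : Entry) : Prepared :=
  ⟨e, rows (asChild 2 3 e.un e.mask), rows (asChild 3 2 e.un e.mask),
    columns (asChild 2 3 e.un e.mask), columns (asChild 3 2 e.un e.mask)⟩

/-- The recoloured sets, rows and columns are evaluated once for each entry instead of once for each
pair of entries. -/
def forcePrepared (x : List Entry) : (List Prepared → Bool) → Bool :=
  List.rec (fun f => f []) (fun e _ ih f => ih fun y =>
    force (asChild 2 3 e.un e.mask) fun m₂ => force (asChild 3 2 e.un e.mask) fun m₃ =>
    forceList (rows m₂) fun r₂ => forceList (rows m₃) fun r₃ =>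
    forceList (columns m₂) fun c₂ => forceList (columns m₃) fun c₃ =>
      f (⟨e, r₂, r₃, c₂, c₃⟩ :: y)) x

theorem forcePrepared_eq (x : List Entry) (f : List Prepared → Bool) :
    forcePrepared x f = f (x.map prepared) := by
  induction x generalizing f with
  | nil => rfl
  | cons e x ih =>
    refine (ih _).trans ?_
    simp only [force_eq, forceList_eq]
    rfl

/-- Whether `M` is a subset of `N`. -/
def subset (M N : ℕ) : Bool := Nat.beq (Nat.land M N) M

/-- A tagged entry may be used only when both children are known exactly; an untagged one requires
no knowledge of the shape. -/
def shapeMatches : Option (LTree Unit) → Option (LTree Unit) → Option (LTree Unit) → Bool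
  | none, _, _ => true
  | some s, some t, some t' => LTree.beq s (.bin () t t')
  | _, _, _ => false

def all {α : Type*} (p : α → Bool) (x : List α) : Bool := List.rec true (fun a _ ih => p a && ih) x
def any {α : Type*} (p : α → Bool) (x : List α) : Bool := List.rec false (fun a _ ih => p a || ih) x

theorem all_eq {α : Type*} {p : α → Bool} {x : List α} (h : all p x = true) : ∀ a ∈ x, p a := by
  induction x with
  | nil => simp
  | cons a x ih =>
    obtain ⟨h1, h2⟩ := (Bool.and_eq_true _ _).mp h
    intro b hb
    rcases List.mem_cons.1 hb with rfl | hb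
    · exact h1
    · exact ih h2 b hb

theorem any_eq {α : Type*} {p : α → Bool} {x : List α} (h : any p x = true) : ∃ a ∈ x, p a := by
  induction x with
  | nil => exact absurd h (by simp [any])
  | cons a x ih =>
    rcases (Bool.or_eq_true _ _).mp h with h | h
    · exact ⟨a, by simp, h⟩
    · obtain ⟨b, hb, h⟩ := ih h; exact ⟨b, by simp [hb], h⟩

/-- Every union of two trees has an entry in the table. -/
def checkBin : Bool :=
  forcePrepared table fun y => all (fun a => all (fun b =>
    force (Nat.lor (dot a.rows₂ b.columns₃) (dot a.rows₃ b.columns₂)) fun P => any (fun e =>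
      !e.un && (subset e.mask P && shapeMatches e.shape a.entry.shape b.entry.shape)) table) y) y

theorem checkBin_eq : checkBin = true := by decide +kernel

/-- The exceptional trees have no vertices of degree two, so here only untagged entries are admitted
as results. -/
def checkUn : Bool :=
  all (fun a => force (step a.un a.mask) fun P => any (fun e =>
    e.un && (subset e.mask P && e.shape.isNone)) table) table

theorem checkUn_eq : checkUn = true := by decide +kernel

/-- Every tree has an entry in the table that it fits. -/
theorem exists_fits (s : LTree Unit) : ∃ e ∈ table, e.Fits s := by
  induction s with
  | leaf v =>
    have : ∃ e ∈ table, (e.un = false ∧ e.mask = (1 <<< (2 + 4 * 1 + 16 * 3 + 64 * 1)) |||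
        (1 <<< (3 + 4 * 1 + 16 * 2 + 64 * 1))) ∧ e.shape = some (.leaf ()) :=
      ⟨⟨some (.leaf ()), false, _⟩, by
        simp only [table, List.mem_append, List.mem_map]
        exact .inr (.inr ⟨_, List.mem_cons_self, rfl⟩), ⟨rfl, by decide⟩, rfl⟩
    obtain ⟨e, he, ⟨h1, h2⟩, h3⟩ := this
    exact ⟨e, he, h1, h2 ▸ within_leaf, fun s' h => by rw [h3] at h; exact (Option.some.inj h).symm⟩
  | un v s ih =>
    obtain ⟨a, ha, h1, h2, h3⟩ := ih
    have := all_eq checkUn_eq a ha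
    rw [force_eq] at this
    obtain ⟨e, he, h⟩ := any_eq this
    simp only [Bool.and_eq_true, subset] at h
    obtain ⟨h4, h5, h6⟩ := h
    refine ⟨e, he, h4, ?_, fun s' h => by simp [h] at h6⟩
    rw [h1] at h5
    exact (h2.un).mono (Nat.eq_of_beq_eq_true h5)
  | bin v s s' ih ih' =>
    obtain ⟨a, ha, h1, h2, h3⟩ := ih
    obtain ⟨b, hb, h1', h2', h3'⟩ := ih'
    have := checkBin_eq
    rw [checkBin, forcePrepared_eq] at this
    have := all_eq (all_eq this _ (List.mem_map_of_mem ha)) _ (List.mem_map_of_mem hb)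
    rw [force_eq] at this
    obtain ⟨e, he, h⟩ := any_eq this
    simp only [Bool.and_eq_true, subset, Bool.not_eq_true'] at h
    obtain ⟨h4, h5, h6⟩ := h
    refine ⟨e, he, h4, ?_, fun t h => ?_⟩
    · simp only [prepared, h1, h1'] at h5
      exact (h2.bin h2').mono (Nat.eq_of_beq_eq_true h5)
    · rw [h] at h6
      simp only [prepared] at h6
      cases hs : a.shape <;> cases hs' : b.shape <;> rw [hs, hs'] at h6 <;>
        simp only [shapeMatches, Bool.false_eq_true] at h6
      rw [LTree.eq_of_beq h6, h3 _ hs, h3' _ hs']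

/-! ### Completing the colouring at the root leaf, and the exceptional trees. -/

/-- The quadruples at a tree that can be completed at the parent of its root. -/
def closing (un : Bool) : ℕ :=
  bif un then 0x808008800004004000000440000200202020000000060060a0a00cc0000
  else 0x880000000000000044000020020202000000002002020200cc0000

theorem within_closing (b : Bool) : Within (closing b) fun l m r n =>
    ∃ d : Fin 4, [r, 0, l, d].Nodup ∧ d ≠ m ∧ n ≠ d ∧ (b = false → d ≠ 1) := by
  intro k hk
  refine of_testBit (p := fun k => ∃ d : Fin 4, [digit 2 k, 0, digit 0 k, d].Nodup ∧
    d ≠ digit 1 k ∧ digit 3 k ≠ d ∧ (b = false → d ≠ 1)) ?_ ?_ hk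
  · cases b <;> decide +kernel
  · cases b <;> decide +kernel

/-- The tree, rooted at each of its leaves. -/
def exceptional {n : ℕ} (x : Fin n × LTree (Fin n)) : List (Fin n × LTree (Fin n)) :=
  -- The leaf at the top is not among `leaves`, hence the additional rooting.
  List.iterate LTree.rotate x (x.2.leaves.length + 1)

open LTree in
def treeK4 : Fin 4 × LTree (Fin 4) := (0, bin 3 (leaf 1) (leaf 2))

open LTree in
def treeH4 : Fin 10 × LTree (Fin 10) :=
  (4, bin 0 (leaf 5) (bin 1 (leaf 6) (bin 2 (leaf 7) (bin 3 (leaf 8) (leaf 9)))))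

open LTree in
def treeH5 : Fin 12 × LTree (Fin 12) :=
  (5, bin 0 (leaf 6) (bin 1 (leaf 7) (bin 2 (leaf 8) (bin 3 (leaf 9) (bin 4 (leaf 10) (leaf 11))))))

open LTree in
def treeH8 : Fin 18 × LTree (Fin 18) :=
  (8, bin 0 (leaf 9) (bin 1 (bin 2 (leaf 10) (bin 3 (leaf 11) (bin 4 (leaf 12) (leaf 13))))
    (bin 5 (bin 6 (bin 7 (leaf 14) (leaf 15)) (leaf 16)) (leaf 17))))

/-- The single leaf stands for a tree with only two leaves in all, which is not a Halin tree; the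
other shapes are those of the four exceptional graphs. -/
def exceptionalShapes : List (LTree Unit) :=
  .leaf () :: ((exceptional treeK4).map (fun x => x.2.shape) ++
    ((exceptional treeH4).map (fun x => x.2.shape) ++
    ((exceptional treeH5).map (fun x => x.2.shape) ++
    (exceptional treeH8).map (fun x => x.2.shape))))

def isExceptional : Option (LTree Unit) → Bool
  | none => false
  | some s => any (LTree.beq s) exceptionalShapes

/-- An untagged entry never counts as exceptional, so it has to contain a quadruple that can be
completed. -/
theorem check_closing : all (fun e => !Nat.beq (Nat.land e.mask (closing e.un)) 0 ||
    isExceptional e.shape) table = true := by decide +kernel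

theorem exists_properAt (s : LTree Unit) (hs : s ∉ exceptionalShapes) :
    ∃ (b : Lab) (t : LTree Lab), t.shape = s ∧ t.ProperAt b := by
  obtain ⟨e, he, h1, h2, h3⟩ := exists_fits s
  rcases (Bool.or_eq_true _ _).mp (all_eq check_closing e he) with h | h
  · have h0 : Nat.land e.mask (closing e.un) ≠ 0 := fun h0 => by rw [h0] at h; simp at h
    obtain ⟨k, hk⟩ := Nat.exists_testBit_of_ne_zero h0
    have hk' : (e.mask &&& closing e.un).testBit k = true := hk
    rw [Nat.testBit_land, Bool.and_eq_true] at hk'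
    obtain ⟨d, c1, c2, c3, c4⟩ := (within_closing _ k hk'.2).2
    rw [h1] at c4
    exact (h2 k hk'.1).2.close c1 c2 c3 c4
  · cases hsh : e.shape with
    | none => rw [hsh] at h; exact absurd h (by simp [isExceptional])
    | some s' =>
      rw [hsh] at h
      replace h : any (LTree.beq s') exceptionalShapes = true := h
      obtain ⟨x, hx, h⟩ := any_eq h
      rw [h3 _ hsh] at h
      exact absurd (LTree.eq_of_beq h ▸ hx) hs

end Mask

/-! ### Recognizing the exceptional graphs by their shapes. -/

/-- A graph that consists of a tree and of the cycle through its leaves is determined by the shape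
of the tree. -/
theorem LTree.nonempty_iso {V W : Type*} {G : SimpleGraph V} {H : SimpleGraph W} {p : V}
    {t : LTree V} {q : W} {s : LTree W}
    (hnd : (p :: t.verts).Nodup) (hall : ∀ v, v ∈ p :: t.verts)
    (hG : ∀ u v, G.Adj u v ↔ (u, v) ∈ t.arcs p ++ t.rim p ∨ (v, u) ∈ t.arcs p ++ t.rim p)
    (hnd' : (q :: s.verts).Nodup) (hall' : ∀ v, v ∈ q :: s.verts)
    (hH : ∀ u v, H.Adj u v ↔ (u, v) ∈ s.arcs q ++ s.rim q ∨ (v, u) ∈ s.arcs q ++ s.rim q)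
    (h : t.shape = s.shape) : Nonempty (G ≃g H) := by
  classical
  have : Nonempty W := ⟨q⟩
  obtain ⟨f₀, hf₀⟩ := exists_map_eq (List.nodup_cons.1 hnd).2 h.symm
  set f := Function.update f₀ p q
  have hp : f p = q := Function.update_self _ _ _
  have hs : t.map f = s := by
    rw [← hf₀]
    exact map_congr _ fun v hv => Function.update_of_ne
      (by rintro rfl; exact (List.nodup_cons.1 hnd).1 hv) _ _
  clear_value f
  subst hp hs
  have hlist : (p :: t.verts).map f = f p :: (t.map f).verts := by simp
  rw [← hlist] at hnd' hall'
  have hinj : f.Injective := fun u v huv =>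
    List.inj_on_of_nodup_map hnd' (hall u) (hall v) huv
  have hsurj : f.Surjective := fun w => by
    obtain ⟨v, -, h⟩ := List.mem_map.1 (hall' w); exact ⟨v, h⟩
  have hmem : ∀ u v, (f u, f v) ∈ (t.map f).arcs (f p) ++ (t.map f).rim (f p) ↔
      (u, v) ∈ t.arcs p ++ t.rim p := by
    -- Arcs and rim commute with relabelling, and the relabelling is injective.
    intro u v
    rw [arcs_map, rim_map, ← List.map_append]
    exact List.mem_map_of_injective (hinj.prodMap hinj) (a := (u, v))
  exact ⟨⟨Equiv.ofBijective f ⟨hinj, hsurj⟩, fun {u v} => by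
    change H.Adj (f u) (f v) ↔ G.Adj u v
    rw [hH, hG, hmem, hmem]⟩⟩

/-- The rooted trees in the list all represent the graph. -/
def Represents {n : ℕ} (H : SimpleGraph (Fin n)) (l : List (Fin n × LTree (Fin n))) : Prop :=
  ∀ x ∈ l, (x.1 :: x.2.verts).Nodup ∧ (∀ v, v ∈ x.1 :: x.2.verts) ∧
    ∀ u v, H.Adj u v ↔ (u, v) ∈ x.2.arcs x.1 ++ x.2.rim x.1 ∨
      (v, u) ∈ x.2.arcs x.1 ++ x.2.rim x.1

instance {n : ℕ} (H : SimpleGraph (Fin n)) [DecidableRel H.Adj]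
    (l : List (Fin n × LTree (Fin n))) : Decidable (Represents H l) :=
  inferInstanceAs (Decidable (∀ x ∈ l, _))

instance : DecidableRel graphH4.Adj := by unfold graphH4; infer_instance
instance : DecidableRel graphH5.Adj := by unfold graphH5; infer_instance
instance : DecidableRel graphH8.Adj := by unfold graphH8; infer_instance

/-- All rootings describe the same labelled graph, so agreement of shapes with any one of them gives
an isomorphism. -/
theorem represents_K4 : Represents (⊤ : SimpleGraph (Fin 4)) (Mask.exceptional Mask.treeK4) := by
  decide +kernel
theorem represents_H4 : Represents graphH4 (Mask.exceptional Mask.treeH4) := by decide +kernel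
theorem represents_H5 : Represents graphH5 (Mask.exceptional Mask.treeH5) := by decide +kernel
theorem represents_H8 : Represents graphH8 (Mask.exceptional Mask.treeH8) := by decide +kernel

/-! ### The lower bound and the conclusion. -/

/-- The colours at `v` in `c` are at most as many as the edges at `v`, and in the proper colouring
`c'` these edges have distinct colours; with at least `k` of them, all `k` colours appear. -/
theorem colorsAt_eq_univ {V α : Type*} [Finite V] {G : SimpleGraph V} {k : ℕ}
    (c : G.lineGraph.Coloring α) (c' : G.lineGraph.Coloring (Fin k)) {v : V}
    (h : k ≤ (colorsAt c v).ncard) : colorsAt c' v = Set.univ := by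
  let E : Set G.edgeSet := {e | v ∈ (e : Sym2 V)}
  have hinj : Set.InjOn c' E := by
    intro e he e' he' hee'
    by_contra hne
    exact c'.valid (SimpleGraph.lineGraph_adj_iff_exists.2 ⟨hne, v, he, he'⟩) hee'
  apply Set.eq_of_subset_of_ncard_le (Set.subset_univ _)
  rw [Set.ncard_univ, Nat.card_eq_fintype_card, Fintype.card_fin]
  refine h.trans ?_
  have h1 : (colorsAt c v).ncard ≤ E.ncard := Set.ncard_image_le (Set.toFinite _)
  have h2 : (colorsAt c' v).ncard = E.ncard := hinj.ncard_image
  omega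

theorem theorem2 {V : Type*} [Fintype V] (G : SimpleGraph V) [DecidableRel G.Adj]
    (hG : IsHalin G) (hdeg : ∀ v, G.degree v ≤ 3)
    (hK4 : IsEmpty (G ≃g (⊤ : SimpleGraph (Fin 4))))
    (hH4 : IsEmpty (G ≃g graphH4))
    (hH5 : IsEmpty (G ≃g graphH5))
    (hH8 : IsEmpty (G ≃g graphH8)) :
    avdChromaticIndex G = 4 := by
  obtain ⟨p, t, hnd, hall, hlen, hadj⟩ := hG.exists_tree fun v => by
    rw [← SimpleGraph.coe_neighborFinset, Set.encard_coe_eq_coe_finsetCard,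
      SimpleGraph.card_neighborFinset_eq_degree]
    exact_mod_cast hdeg v
  have hiso : ∀ {n : ℕ} {H : SimpleGraph (Fin n)} {l : List (Fin n × LTree (Fin n))},
      Represents H l → t.shape ∈ l.map (fun x => x.2.shape) → Nonempty (G ≃g H) := by
    intro n H l hl ht
    obtain ⟨x, hx, h⟩ := List.mem_map.1 ht
    obtain ⟨h1, h2, h3⟩ := hl x hx
    exact LTree.nonempty_iso hnd hall hadj h1 h2 h3 h.symm
  have hshape : t.shape ∉ Mask.exceptionalShapes := by
    simp only [Mask.exceptionalShapes, List.mem_cons, List.mem_append, not_or]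
    refine ⟨fun h => ?_, fun h => hK4.elim' (hiso represents_K4 h).some,
      fun h => hH4.elim' (hiso represents_H4 h).some,
      fun h => hH5.elim' (hiso represents_H5 h).some,
      fun h => hH8.elim' (hiso represents_H8 h).some⟩
    cases t <;> simp [LTree.shape, LTree.map, LTree.leaves] at h hlen
  obtain ⟨b, t', ht', hprop⟩ := Mask.exists_properAt t.shape hshape
  obtain ⟨hp, hnt⟩ := List.nodup_cons.1 hnd
  classical
  have : Nonempty Lab := ⟨b⟩
  obtain ⟨f, rfl⟩ := LTree.exists_map_eq hnt ht'
  have hf : t.map (Function.update f p b) = t.map f := LTree.map_congr _ fun v hv =>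
    Function.update_of_ne (by rintro rfl; exact hp hv) _ _
  obtain ⟨c, hc, u, v, huv, hu, hv⟩ := LTree.exists_isAVD hnd hall hlen hadj
    (Function.update f p b) (by rwa [hf, Function.update_self])
  apply le_antisymm
  · exact iInf₂_le_of_le 4 ⟨c, hc⟩ le_rfl
  · refine le_iInf₂ fun k hk => ?_
    obtain ⟨c', hc'⟩ := hk
    by_contra hlt
    have hk3 : k ≤ 3 := by
      have : (k : ℕ∞) < (4 : ℕ) := not_le.1 hlt
      have : k < 4 := by exact_mod_cast this
      omega
    -- With at most three colours, both of the adjacent vertices `u` and `v` would see all of them.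
    exact hc' u v huv ((colorsAt_eq_univ c c' (hu ▸ hk3)).trans
      (colorsAt_eq_univ c c' (hv ▸ hk3)).symm)
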